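/- **Rules.** The game is played on an $8\times 8$ chessboard. White has a king and a queen, Black has only a king, and White moves first from a configuration in which the three pieces stand on three different squares. The pieces move as in chess and the players alternate; passing is not allowed. There is no check, checkmate, stalemate or draw: a king may move to an attacked square (next to the other king included), and a player wins by capturing the opponent's king. The Black king may also capture the queen, and the game then goes on. At the start and after each move of either player, White sees the own pieces, the squares to which a White piece can legally move (a queen's line of sight ends at the first piece on it), and the Black king if and only if it stands on such a square. A strategy of White assigns a legal move to the sequence of everything that White has seen so far. It wins from a configuration if, whatever moves Black makes, the White king is never captured and the Black king is captured after finitely many moves. A *corner configuration* is a configuration in which the White king stands on one of A1, A8, H1, H8 and the White queen stands on a square adjacent to it. **Statement.** There is a strategy $\tau$ of White (for the second stage) such that: 1. $\tau$ wins from every corner configuration with White to move, wherever the Black king stands; $\tau$ uses only what White sees from that moment on, so White need not know where the Black king is. 2. For every initial configuration there is a strategy $\sigma$ of White (for the first stage; it may depend on the initial configuration, since White knows the initial square of the Black king) such that the following two-stage strategy wins from that configuration: White plays by $\sigma$ until, for the first time, White is to move in a corner configuration (or until the Black king is captured), and from then on plays by $\tau$, applied to what White has seen since that moment. In particular, a White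 player who has a king and a queen against a lone king, moves first and knows the initial square of the Black king has a strategy that captures the Black king, however Black plays. -/

import Mathlib

namespace FogChess

/-- A square of the `8 × 8` board, given as (file, rank); `(0, 0)` is A1 and `(7, 7)` is H8. -/
abbrev Square := Fin 8 × Fin 8

/-- The integer coordinates of a square. -/
def coord (s : Square) : ℤ × ℤ := ((s.1.val : ℤ), (s.2.val : ℤ))

/-- The eight directions of movement of a king or a queen. -/
def directions : Finset (ℤ × ℤ) :=
  {(1, 0), (1, 1), (0, 1), (-1, 1), (-1, 0), (-1, -1), (0, -1), (1, -1)}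

/-- Two squares are adjacent if they are one king's step apart. -/
def Adjacent (s t : Square) : Prop :=
  ∃ d ∈ directions, coord t = coord s + d

instance (s t : Square) : Decidable (Adjacent s t) := by
  unfold Adjacent; infer_instance

/-- A queen on `s` can slide to `t` when the squares in `occ` are occupied: `t` is `n` steps away
in one of the eight directions, and none of the squares strictly between is occupied. -/
def QueenReach (occ : Finset Square) (s t : Square) : Prop :=
  ∃ d ∈ directions, ∃ n ∈ Finset.Icc (1 : ℕ) 7, coord t = coord s + n • d ∧
    ∀ m ∈ Finset.Ico (1 : ℕ) n, ∀ u ∈ occ, coord u ≠ coord s + m • d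

instance (occ : Finset Square) (s t : Square) : Decidable (QueenReach occ s t) := by
  unfold QueenReach; infer_instance

/-- The position of all pieces: the White king, the White queen (`none` once it has been captured)
and the Black king. -/
structure Config where
  wk : Square
  wq : Option Square
  bk : Square
  deriving DecidableEq

/-- A move of White: move the king, or the queen, to the given square. -/
inductive Move where
  | king (t : Square)
  | queen (t : Square)
  deriving DecidableEq

/-- The square to which a White piece is moved. -/
def Move.target : Move → Square
  | .king t => t
  | .queen t => t

/-- Legal moves of White. A piece may not move onto a square occupied by a piece of its own colour.
Moving onto the square of the Black king captures it. There is no check, so moving the king to a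
square attacked by the Black king is legal. -/
def Config.Legal (c : Config) : Move → Prop
  | .king t => Adjacent c.wk t ∧ c.wq ≠ some t
  | .queen t => ∃ q, c.wq = some q ∧ QueenReach {c.wk, c.bk} q t ∧ t ≠ c.wk

instance (c : Config) (m : Move) : Decidable (c.Legal m) := by
  cases m <;> (simp only [Config.Legal]; infer_instance)

/-- The configuration after a move of White that does not capture the Black king. -/
def Config.move (c : Config) : Move → Config
  | .king t => { c with wk := t }
  | .queen t => { c with wq := some t }

/-- The configuration after the Black king has moved to `t`, capturing the queen if it is there. -/
def Config.blackMove (c : Config) (t : Square) : Config where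
  wk := c.wk
  wq := if c.wq = some t then none else c.wq
  bk := t

/-- The squares that White observes: those to which a White piece can legally move. -/
def Config.visible (c : Config) : Finset Square :=
  Finset.univ.filter fun t => c.Legal (.king t) ∨ c.Legal (.queen t)

/-- What White sees at one moment of the game: the own pieces, the set of observed squares, and the
Black king, provided that it stands on an observed square. -/
structure View where
  king : Square
  queen : Option Square
  visible : Finset Square
  blackKing : Option Square
  deriving DecidableEq

/-- White's view of a configuration. -/
def Config.view (c : Config) : View where
  king := c.wk
  queen := c.wq
  visible := c.visible
  blackKing := if c.bk ∈ c.visible then some c.bk else none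

/-- A (deterministic) strategy for White chooses a move from the list of everything White has seen
so far, in chronological order: the view at the start, and then the view after every single move of
either player. -/
abbrev Strategy := List View → Move

/-- `σ.Wins h c`: White is to move in the configuration `c`, has so far collected the list of views
`h` (the last one being the view of `c`), and, if White follows `σ` from now on, all of White's
moves are legal, the White king is never captured, and the Black king is captured after finitely
many moves, whatever moves Black makes. Black has to move, and may move to any adjacent square. -/
inductive Strategy.Wins (σ : Strategy) : List View → Config → Prop
  | capture (h : List View) (c : Config) (legal : c.Legal (σ h)) (target : (σ h).target = c.bk) :
      σ.Wins h c
  | step (h : List View) (c : Config) (legal : c.Legal (σ h)) (target : (σ h).target ≠ c.bk)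
      (safe : ¬ Adjacent c.bk (c.move (σ h)).wk)
      (next : ∀ t, Adjacent c.bk t →
        σ.Wins (h ++ [(c.move (σ h)).view, ((c.move (σ h)).blackMove t).view])
          ((c.move (σ h)).blackMove t)) :
      σ.Wins h c

/-- White, moving first from `c` and following `σ`, wins against every play of Black. -/
def Strategy.WinsFrom (σ : Strategy) (c : Config) : Prop :=
  σ.Wins [c.view] c

/-- The pieces stand on three different squares, the queen being on the board. -/
def Config.IsInitial (c : Config) : Prop :=
  ∃ q, c.wq = some q ∧ c.wk ≠ q ∧ c.wk ≠ c.bk ∧ q ≠ c.bk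

/-- The four corner squares A1, A8, H1, H8. -/
def corners : Finset Square := {(0, 0), (0, 7), (7, 0), (7, 7)}

/-- White sees a corner configuration: the White king stands on a corner square and the White queen
on an adjacent square. -/
def View.IsCorner (v : View) : Prop :=
  v.king ∈ corners ∧ ∃ q, v.queen = some q ∧ Adjacent v.king q

instance (v : View) : Decidable v.IsCorner := by
  unfold View.IsCorner; infer_instance

/-- The part of the list of views that starts when, for the first time, White is to move in a corner
configuration (the empty list if that has not happened yet). The list begins with White to move, and
views with White to move and with Black to move alternate. -/
def sinceCorner : List View → List View
  | [] => []
  | [v] => if v.IsCorner then [v] else []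
  | v :: w :: h => if v.IsCorner then v :: w :: h else sinceCorner h

/-- The two-stage strategy: White follows `σ` until, for the first time, White is to move in a corner
configuration; from then on White follows `τ`, applied only to what White has seen since that
moment. -/
def twoStage (σ τ : Strategy) : Strategy := fun h =>
  if sinceCorner h = [] then σ h else τ (sinceCorner h)

end FogChess

namespace FogChess

/-! ### Transferring and combining strategies -/

/-! The hidden game is turned into an open one whose states consist of the White king, the White
queen and a belief: a set of squares containing the Black king. A strategy for a belief also works
for every smaller one. A Black king seen with White to move is captured at once, so only unseen
squares matter. A White move is safe if, from every square of the belief, Black can capture neither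
the White king nor an unprotected queen; a queen protected by the king may be offered, since the
capturing king is then captured (`BeliefWin.after_black`). After the move White either sees the
Black king, and the belief shrinks to the neighbours of one square, or does not, and the seen
squares are dropped before the belief spreads by one king step. This is `BeliefWin.step`.

Second stage: `plan` is a certificate listing safe moves for beliefs. Every belief arising from an
instruction is empty or contained in the belief of a later instruction, so induction along the list
gives a win (`sound_of_checkPlan`); the unseen squares of every corner configuration are covered.

First stage: `cornerTable` assigns ranks to pairs of White squares. At ranks 1 to 14 it gives one
move to a lower rank that is safe wherever an unseen Black king stands; at rank 15 it gives two
moves, at least one of them safe for each unseen square. Rank 15 can occur only at the start, where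
the Black king's square is known. Rank 0 is a corner configuration (`beliefWin_of_checkTable`).

Both certificates are verified by computation with bit masks. The game-theoretic lemmas are stated
for a completion `Φ` of strategies, so that they serve both stages: `Φ` is the identity in the
second and hands over to `τ` in the first. -/

theorem Strategy.Wins.transfer {σ σ' : Strategy} {h' : List View} {c : Config}
    (w : σ'.Wins h' c) :
    ∀ h : List View, (∀ t, σ (h ++ t) = σ' (h' ++ t)) → σ.Wins h c := by
  induction w with
  | capture h' c legal target =>
    intro h e
    have e0 : σ h = σ' h' := by simpa using e []
    exact .capture h c (e0 ▸ legal) (e0 ▸ target)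
  | step h' c legal target safe next ih =>
    intro h e
    have e0 : σ h = σ' h' := by simpa using e []
    refine .step h c (e0 ▸ legal) (e0 ▸ target) (e0 ▸ safe) fun t ht => ?_
    rw [e0]
    exact ih t ht _ fun u => by rw [List.append_assoc, List.append_assoc]; exact e _

/-- `Φ` turns a strategy into one that hands over to a fixed winning strategy at the first moment
at which White is to move with a view satisfying `done`, and that changes nothing before. -/
structure HandsOver (Φ : Strategy → Strategy) (done : View → Prop) : Prop where
  congr : ∀ σ σ' h, σ h = σ' h → Φ σ h = Φ σ' h
  first : ∀ σ v, ¬ done v → Φ σ [v] = σ [v]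
  shift : ∀ σ v v₁ v₂ h, ¬ done v →
    Φ σ (v :: v₁ :: v₂ :: h) = Φ (fun l => σ (v :: v₁ :: l)) (v₂ :: h)
  wins : ∀ σ (c : Config), c.IsInitial → done c.view → (Φ σ).WinsFrom c

/-- The case of the second stage, in which nothing is handed over. -/
theorem handsOver_id : HandsOver id fun _ => False where
  congr _ _ _ h := h
  first _ _ _ := rfl
  shift _ _ _ _ _ _ := rfl
  wins _ _ _ h := h.elim

theorem sinceCorner_append {v : View} (hv : v.IsCorner) (t : List View) :
    sinceCorner (v :: t) = v :: t := by
  cases t <;> simp [sinceCorner, hv]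

/-- The case of the first stage. `shift` holds because `sinceCorner` discards views in pairs,
testing only those with White to move; `wins` holds because from a corner configuration on it
returns the whole history. -/
theorem handsOver_twoStage {τ : Strategy}
    (hτ : ∀ c : Config, c.IsInitial → c.view.IsCorner → τ.WinsFrom c) :
    HandsOver (fun σ => twoStage σ τ) View.IsCorner where
  congr σ σ' h e := by simp [twoStage, e]
  first σ v hv := by simp [twoStage, sinceCorner, hv]
  shift σ v v₁ v₂ h hv := by simp [twoStage, sinceCorner, hv]
  wins σ c hc hv := (hτ c hc hv).transfer _ fun t => by
    simp [twoStage, sinceCorner_append hv]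

/-- One strategy, completed by `Φ`, wins from all configurations in `C`. -/
def Winnable (Φ : Strategy → Strategy) (C : Set Config) : Prop :=
  ∃ σ, ∀ c ∈ C, (Φ σ).WinsFrom c

theorem Winnable.mono {Φ : Strategy → Strategy} {C D : Set Config} (h : Winnable Φ D)
    (hCD : C ⊆ D) : Winnable Φ C :=
  h.imp fun _ hσ c hc => hσ c (hCD hc)

/-- The move capturing the Black king on the visible square `t`. -/
def captureMove (v : View) (t : Square) : Move :=
  if Adjacent v.king t ∧ v.queen ≠ some t then .king t else .queen t

theorem captureMove_target (v : View) (t : Square) : (captureMove v t).target = t := by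
  unfold captureMove; split_ifs <;> rfl

theorem legal_captureMove {c : Config} {t : Square} (h : t ∈ c.visible) :
    c.Legal (captureMove c.view t) := by
  have h' : c.Legal (.king t) ∨ c.Legal (.queen t) := by simpa [Config.visible] using h
  unfold captureMove
  split_ifs with hk
  · exact hk
  · exact h'.resolve_left hk

/-- It suffices to win from the configurations in which the Black king is not seen. -/
theorem Winnable.of_unseen {Φ : Strategy → Strategy} {done : View → Prop}
    (hΦ : HandsOver Φ done) {C : Set Config} (hC : ∀ c ∈ C, done c.view → c.IsInitial)
    (h : Winnable Φ {c ∈ C | c.bk ∉ c.visible}) : Winnable Φ C := by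
  obtain ⟨σ, hσ⟩ := h
  -- The decision depends on the first view only. It stays the head of every longer history, so if
  -- the Black king is not seen there, `σ` is followed for ever.
  refine ⟨fun l => match l.head? with
    | some v => match v.blackKing with
      | some t => captureMove v t
      | none => σ l
    | none => σ l, fun c hc => ?_⟩
  by_cases hs : done c.view
  · exact hΦ.wins _ c (hC c hc hs) hs
  by_cases hv : c.bk ∈ c.visible
  · have hb : c.view.blackKing = some c.bk := by simp [Config.view, hv]
    refine .capture _ _ ?_ ?_ <;> rw [hΦ.first _ _ hs] <;> simp only [List.head?_cons, hb]
    · exact legal_captureMove hv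
    · exact captureMove_target _ _
  · have hb : c.view.blackKing = none := by simp [Config.view, hv]
    refine (hσ c ⟨hc, hv⟩).transfer _ fun t => hΦ.congr _ _ _ ?_
    simp [hb]

/-- White makes the same move `m` in all configurations in `C`, and goes on depending on what is
seen before the answer of Black. -/
theorem Winnable.step {Φ : Strategy → Strategy} {done : View → Prop}
    (hΦ : HandsOver Φ done) {C : Set Config} (hdone : ∀ c ∈ C, done c.view → c.IsInitial) (m : Move)
    (legal : ∀ c ∈ C, c.Legal m) (target : ∀ c ∈ C, m.target ≠ c.bk)
    (safe : ∀ c ∈ C, ¬ Adjacent c.bk (c.move m).wk)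
    (next : ∀ v : View, Winnable Φ {c' | ∃ c ∈ C, (c.move m).view = v ∧
      ∃ t, Adjacent c.bk t ∧ c' = (c.move m).blackMove t}) : Winnable Φ C := by
  choose f hf using next
  -- The view after White's own move selects the continuation, which then sees a history starting
  -- after Black's reply.
  let σ : Strategy := fun l => match l with
    | _ :: v₁ :: h => f v₁ h
    | _ => m
  refine ⟨σ, fun c hc => ?_⟩
  by_cases hs : done c.view
  · exact hΦ.wins _ c (hdone c hc hs) hs
  have hm : Φ σ [c.view] = m := hΦ.first σ _ hs
  refine .step _ _ ?_ ?_ ?_ fun t ht => ?_ <;> rw [hm]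
  · exact legal c hc
  · exact target c hc
  · exact safe c hc
  · exact (hf _ _ ⟨c, hc, rfl, t, ht, rfl⟩).transfer _ fun u => hΦ.shift σ _ _ _ _ hs

/-! ### Winning with partial knowledge of the square of the Black king -/

/-- White wins with the king on `K`, the queen on `Q`, knowing that the Black king is in `B`. -/
def BeliefWin (Φ : Strategy → Strategy) (K Q : Square) (B : Set Square) : Prop :=
  Winnable Φ {c | c.wk = K ∧ c.wq = some Q ∧ c.bk ∈ B ∧ c.IsInitial}

/-- White does not see a Black king standing on `b`. -/
def Unseen (K Q b : Square) : Prop := b ∉ Config.visible ⟨K, some Q, b⟩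

theorem BeliefWin.mono {Φ : Strategy → Strategy} {K Q : Square} {A B : Set Square}
    (h : BeliefWin Φ K Q B) (hAB : A ⊆ B) : BeliefWin Φ K Q A :=
  Winnable.mono h fun _ ⟨h₁, h₂, h₃, h₄⟩ => ⟨h₁, h₂, hAB h₃, h₄⟩

theorem BeliefWin.empty (Φ : Strategy → Strategy) (K Q : Square) : BeliefWin Φ K Q ∅ :=
  ⟨fun _ => .king K, fun _ hc => hc.2.2.1.elim⟩

theorem isInitial_iff {K Q b : Square} :
    Config.IsInitial ⟨K, some Q, b⟩ ↔ K ≠ Q ∧ K ≠ b ∧ Q ≠ b := by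
  simp [Config.IsInitial]

theorem BeliefWin.of_unseen {Φ : Strategy → Strategy} {done : View → Prop}
    (hΦ : HandsOver Φ done) {K Q : Square} {B : Set Square}
    (h : BeliefWin Φ K Q {b ∈ B | Unseen K Q b ∧ b ≠ K ∧ b ≠ Q}) : BeliefWin Φ K Q B := by
  refine Winnable.of_unseen hΦ (fun c hc _ => hc.2.2.2) (Winnable.mono h ?_)
  rintro ⟨k, q, b⟩ ⟨⟨rfl, rfl, hb, hi⟩, hv⟩
  obtain ⟨-, h₂, h₃⟩ := isInitial_iff.1 hi
  exact ⟨rfl, rfl, ⟨hb, hv, h₂.symm, h₃.symm⟩, hi⟩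

/-- If the queen is protected, then a Black king capturing it is captured. -/
theorem BeliefWin.after_black {Φ : Strategy → Strategy} {done : View → Prop}
    (hΦ : HandsOver Φ done) (hq : ∀ v, done v → v.queen ≠ none) {K Q : Square} (hKQ : K ≠ Q)
    {A B : Set Square}
    (hK : ∀ b ∈ A, ¬ Adjacent b K) (hQ : ∀ b ∈ A, Adjacent b Q → Adjacent K Q)
    (h : BeliefWin Φ K Q B)
    (hAB : ∀ b ∈ A, ∀ t, Adjacent b t → Unseen K Q t → t ≠ Q → t ∈ B) :
    Winnable Φ {c' | ∃ b ∈ A, ∃ t, Adjacent b t ∧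
      c' = Config.blackMove ⟨K, some Q, b⟩ t} := by
  have hne : ∀ b ∈ A, ∀ t, Adjacent b t → K ≠ t := by
    rintro b hb t ht rfl
    exact hK b hb ht
  refine Winnable.of_unseen hΦ ?_ (Winnable.mono h ?_)
  · rintro _ ⟨b, hb, t, ht, rfl⟩ hs
    -- If the queen has just been captured, `hq` excludes handing over; otherwise the three squares
    -- are distinct.
    by_cases hQt : Q = t
    · subst hQt
      exact absurd (by simp [Config.view, Config.blackMove]) (hq _ hs)
    · simpa [Config.blackMove, hQt] using isInitial_iff.2 ⟨hKQ, hne b hb t ht, hQt⟩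
  · rintro _ ⟨⟨b, hb, t, ht, rfl⟩, hv⟩
    by_cases hQt : Q = t
    · subst hQt
      refine absurd ?_ hv
      simp only [Config.blackMove, Config.visible, if_true, Finset.mem_filter, Finset.mem_univ,
        true_and]
      exact .inl ⟨hQ b hb ht, by simp⟩
    · simp only [Config.blackMove, Option.some.injEq, hQt, if_false] at hv ⊢
      exact ⟨rfl, rfl, hAB b hb t ht hv (Ne.symm hQt), isInitial_iff.2 ⟨hKQ, hne b hb t ht, hQt⟩⟩

/-- One move of White, leading to the squares `K'` and `Q'`. -/
structure MoveTo (K Q K' Q' : Square) : Prop where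
  ne : K' ≠ Q'
  exists_move : ∃ m : Move, (∀ b, Config.move ⟨K, some Q, b⟩ m = ⟨K', some Q', b⟩) ∧
    ∀ b, Unseen K Q b → Config.Legal ⟨K, some Q, b⟩ m

/-- `inv` and `vis` treat the two kinds of view between White's move and Black's reply. With the
Black king unseen, one belief `S` serves all its squares; with the king seen on `b`, only the
neighbours of `b` remain. -/
theorem BeliefWin.step {Φ : Strategy → Strategy} {done : View → Prop}
    (hΦ : HandsOver Φ done) (hq : ∀ v, done v → v.queen ≠ none) {K Q K' Q' : Square}
    (hm : MoveTo K Q K' Q') {B S : Set Square} (hB : ∀ b ∈ B, Unseen K Q b)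
    (hK : ∀ b ∈ B, ¬ Adjacent b K') (hQ : ∀ b ∈ B, Adjacent b Q' → Adjacent K' Q')
    (hS : BeliefWin Φ K' Q' S)
    (inv : ∀ b ∈ B, Unseen K' Q' b → ∀ t, Adjacent b t → Unseen K' Q' t → t ≠ Q' → t ∈ S)
    (vis : ∀ b ∈ B, ¬ Unseen K' Q' b →
      BeliefWin Φ K' Q' {t | Adjacent b t ∧ Unseen K' Q' t ∧ t ≠ Q'}) :
    BeliefWin Φ K Q B := by
  obtain ⟨hne, m, hmove, hlegal⟩ := hm
  refine Winnable.step hΦ (fun c hc _ => hc.2.2.2) m ?_ ?_ ?_ fun v => ?_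
  · rintro ⟨k, q, b⟩ ⟨rfl, rfl, hb, hi⟩
    exact hlegal b (hB b hb)
  · rintro ⟨k, q, b⟩ ⟨rfl, rfl, hb, hi⟩ ht
    refine hB b hb ?_
    have hl := hlegal b (hB b hb)
    simp only [Config.visible, Finset.mem_filter, Finset.mem_univ, true_and]
    cases m with
    | king t => exact .inl (by simpa only [← show t = b from ht] using hl)
    | queen t => exact .inr (by simpa only [← show t = b from ht] using hl)
  · rintro ⟨k, q, b⟩ ⟨rfl, rfl, hb, hi⟩
    rw [hmove]
    exact hK b hb
  -- A view showing the Black king determines its square, so every configuration with this view has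
  -- it on the same `b`.
  · by_cases hv : ∃ b ∈ B, ¬ Unseen K' Q' b ∧ v.blackKing = some b
    · obtain ⟨b, hb, hu, hvb⟩ := hv
      refine (BeliefWin.after_black hΦ hq hne (A := {b}) ?_ ?_ (vis b hb hu) ?_).mono ?_
      · rintro _ rfl
        exact hK _ hb
      · rintro _ rfl
        exact hQ _ hb
      · rintro _ rfl t ht hut hne
        exact ⟨ht, hut, hne⟩
      · rintro _ ⟨⟨k, q, a⟩, ⟨rfl, rfl, ha, hi⟩, hav, t, ht, rfl⟩
        rw [hmove] at hav ⊢
        refine ⟨b, rfl, t, ?_, ?_⟩ <;>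
        · by_cases h : Config.bk ⟨K', some Q', a⟩ ∈ Config.visible ⟨K', some Q', a⟩
          · have : some a = some b := by rw [← hvb, ← hav, Config.view, if_pos h]
            cases this
            first | exact ht | rfl
          · exfalso
            have : none = some b := by rw [← hvb, ← hav, Config.view, if_neg h]
            simp at this
    · refine (BeliefWin.after_black hΦ hq hne (A := {b ∈ B | Unseen K' Q' b})
        (fun b hb => hK b hb.1) (fun b hb => hQ b hb.1) hS
        (fun b hb => inv b hb.1 hb.2)).mono ?_
      rintro _ ⟨⟨k, q, a⟩, ⟨rfl, rfl, ha, hi⟩, hav, t, ht, rfl⟩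
      rw [hmove] at hav ⊢
      refine ⟨a, ⟨ha, fun h => hv ⟨a, ha, fun h' => h' h, ?_⟩⟩, t, ht, rfl⟩
      rw [← hav, Config.view, if_pos h]

/-- A move that is safe wherever the Black king is, to a position won without any knowledge. -/
theorem BeliefWin.step_univ {Φ : Strategy → Strategy} {done : View → Prop}
    (hΦ : HandsOver Φ done) (hq : ∀ v, done v → v.queen ≠ none) {K Q K' Q' : Square}
    (hm : MoveTo K Q K' Q') {B : Set Square} (hB : ∀ b ∈ B, Unseen K Q b)
    (hK : ∀ b ∈ B, ¬ Adjacent b K') (hQ : ∀ b ∈ B, Adjacent b Q' → Adjacent K' Q')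
    (h : BeliefWin Φ K' Q' Set.univ) : BeliefWin Φ K Q B :=
  .step hΦ hq hm hB hK hQ h (fun _ _ _ _ _ _ _ => trivial) fun _ _ _ => h.mono fun _ _ => trivial

/-! ### Sets of squares as bit masks -/

/-- The bit of a square in masks: the board has a margin of width one. -/
def pos (s : Square) : ℕ := s.1.val + 1 + 10 * (s.2.val + 1)

theorem pos_inj {s t : Square} : pos s = pos t ↔ s = t := by
  obtain ⟨⟨x, hx⟩, ⟨y, hy⟩⟩ := s
  obtain ⟨⟨x', hx'⟩, ⟨y', hy'⟩⟩ := t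
  simp only [pos, Prod.mk.injEq, Fin.mk.injEq]
  omega

/-- The mask of all squares of the board. -/
def board : ℕ := 0x1fe7f9fe7f9fe7f9fe7f800

/-- The mask of the single position `p`. -/
def bit (p : ℕ) : ℕ := 1 <<< p

/-- The difference of two masks. -/
def diff (a b : ℕ) : ℕ := a ^^^ (a &&& b)

theorem testBit_bit (p i : ℕ) : (bit p).testBit i = true ↔ p = i := by
  simp [bit, Nat.shiftLeft_eq, Nat.testBit_two_pow]

theorem testBit_diff (a b i : ℕ) : (diff a b).testBit i = (a.testBit i && !b.testBit i) := by
  cases h : a.testBit i <;> simp [diff, h]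

/-- The neighbours of the positions in a mask. -/
def nbrs (a : ℕ) : ℕ :=
  a <<< 1 ||| a <<< 9 ||| a <<< 10 ||| a <<< 11 ||| a >>> 1 ||| a >>> 9 ||| a >>> 10 ||| a >>> 11

/-- The margin of the ten-wide layout prevents wrapping: two squares of the board whose positions
differ by 1, 9, 10 or 11 are truly neighbours. -/
theorem adjacent_iff {s t : Square} : Adjacent s t ↔
    pos t = pos s + 1 ∨ pos t = pos s + 9 ∨ pos t = pos s + 10 ∨ pos t = pos s + 11 ∨
    pos t + 1 = pos s ∨ pos t + 9 = pos s ∨ pos t + 10 = pos s ∨ pos t + 11 = pos s := by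
  obtain ⟨⟨x, hx⟩, ⟨y, hy⟩⟩ := s
  obtain ⟨⟨x', hx'⟩, ⟨y', hy'⟩⟩ := t
  simp only [Adjacent, directions, coord, pos, Finset.mem_insert, Finset.mem_singleton,
    exists_eq_or_imp, exists_eq_left, Prod.mk_add_mk, Prod.mk.injEq]
  omega

theorem testBit_nbrs {a : ℕ} {s t : Square} (h : Adjacent s t) (hs : a.testBit (pos s)) :
    (nbrs a).testBit (pos t) := by
  simp only [nbrs, Nat.testBit_or, Nat.testBit_shiftLeft, Nat.testBit_shiftRight, Bool.or_eq_true,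
    Bool.and_eq_true, decide_eq_true_eq]
  rcases adjacent_iff.1 h with h | h | h | h | h | h | h | h <;> rw [← hs]
  · simp [h]
  · simp [h]
  · simp [h]
  · simp [h]
  · simp [← h, add_comm]
  · simp [← h, add_comm]
  · simp [← h, add_comm]
  · simp [← h, add_comm]

theorem adjacent_of_testBit {s t : Square} (h : (nbrs (bit (pos s))).testBit (pos t)) :
    Adjacent s t := by
  simp only [nbrs, Nat.testBit_or, Nat.testBit_shiftLeft, Nat.testBit_shiftRight, Bool.or_eq_true,
    Bool.and_eq_true, decide_eq_true_eq, testBit_bit] at h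
  rw [adjacent_iff]
  omega

/-- The positions of the squares. -/
def positions : List ℕ := (List.finRange 8).flatMap fun y => (List.finRange 8).map fun x => pos (x, y)

theorem pos_mem_positions (s : Square) : pos s ∈ positions := by
  simp [positions, pos_inj]

theorem testBit_board (s : Square) : board.testBit (pos s) := by
  revert s; decide

theorem exists_pos {p : ℕ} (h : board.testBit p) : ∃ s, pos s = p := by
  have hp : p < 90 := by
    by_contra! hp
    have := Nat.testBit_lt_two_pow (x := board) (i := p)
      ((show board < 2 ^ 90 by decide +kernel).trans_le (Nat.pow_le_pow_right (by norm_num) hp))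
    simp [this] at h
  have key : ∀ p < 90, board.testBit p → p ∈ positions := by decide +kernel
  have := key p hp h
  simp only [positions, List.mem_flatMap, List.mem_map] at this
  obtain ⟨y, -, x, -, h⟩ := this
  exact ⟨_, h⟩

/-! ### The squares seen by White -/

/-- The squares on a ray of at most `n` steps from position `p`, ending before position `k`. A step
adds `δ - 11` to the position. -/
def ray (k δ : ℕ) : ℕ → ℕ → ℕ
  | 0, _ => 0
  | n + 1, p =>
    bif board.testBit (p + δ - 11) && !(p + δ - 11).beq k then
      bit (p + δ - 11) ||| ray k δ n (p + δ - 11)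
    else 0

/-- The squares to which a queen on `q` can move, if only the king on `k` is in its way. -/
def queenMask (k q : ℕ) : ℕ :=
  ray k 12 7 q ||| ray k 22 7 q ||| ray k 21 7 q ||| ray k 20 7 q |||
  ray k 10 7 q ||| ray k 0 7 q ||| ray k 1 7 q ||| ray k 2 7 q

/-- The squares to which a White piece can move. -/
def seenMask (k q : ℕ) : ℕ := queenMask k q ||| diff (board &&& nbrs (bit k)) (bit q)

/-- The displacement in positions, increased by 11, of a direction. -/
def offset (d : ℤ × ℤ) : ℕ := (d.1 + 10 * d.2 + 11).toNat

theorem coord_of_offset {d : ℤ × ℤ} (hd : d ∈ directions) {s t : Square}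
    (h : pos t = pos s + offset d - 11) : coord t = coord s + d := by
  obtain ⟨⟨x, hx⟩, ⟨y, hy⟩⟩ := s
  obtain ⟨⟨x', hx'⟩, ⟨y', hy'⟩⟩ := t
  simp only [directions, Finset.mem_insert, Finset.mem_singleton] at hd
  rcases hd with rfl | rfl | rfl | rfl | rfl | rfl | rfl | rfl <;>
  · simp only [offset, coord, pos, Prod.mk_add_mk, Prod.mk.injEq] at h ⊢
    norm_num at h
    omega

theorem coord_inj {s t : Square} : coord s = coord t ↔ s = t := by
  obtain ⟨⟨x, hx⟩, ⟨y, hy⟩⟩ := s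
  obtain ⟨⟨x', hx'⟩, ⟨y', hy'⟩⟩ := t
  simp [coord]

/-- The squares passed on the way are recorded as members of the same ray: this later shows that a
Black king outside the mask blocks nothing. -/
theorem of_testBit_ray {d : ℤ × ℤ} (hd : d ∈ directions) (K : Square) {p : ℕ} :
    ∀ (n : ℕ) (s : Square), (ray (pos K) (offset d) n (pos s)).testBit p →
      ∃ t, pos t = p ∧ t ≠ K ∧ ∃ m, 1 ≤ m ∧ m ≤ n ∧ coord t = coord s + m • d ∧
        ∀ j, 1 ≤ j → j < m → ∃ u, u ≠ K ∧ coord u = coord s + j • d ∧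
          (ray (pos K) (offset d) n (pos s)).testBit (pos u)
  | 0, s => by simp [ray]
  | n + 1, s => by
    intro h
    rw [ray] at h ⊢
    cases hb : (board.testBit (pos s + offset d - 11) &&
      !(pos s + offset d - 11).beq (pos K)) with
    | false => simp [hb] at h
    | true =>
      simp only [hb, cond_true] at h ⊢
      simp only [Bool.and_eq_true, Bool.not_eq_true'] at hb
      obtain ⟨s', hs'⟩ := exists_pos hb.1
      have hc : coord s' = coord s + d := coord_of_offset hd hs'
      have hK : s' ≠ K := by
        rintro rfl
        simp [hs'] at hb
      rw [← hs'] at h ⊢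
      rw [Nat.testBit_or, Bool.or_eq_true, testBit_bit] at h
      rcases h with h | h
      · exact ⟨s', h, hK, 1, le_rfl, by omega, by simp [hc], by omega⟩
      · obtain ⟨t, ht, htK, m, hm, hmn, hmt, hj⟩ := of_testBit_ray hd K n s' h
        refine ⟨t, ht, htK, m + 1, by omega, by omega, ?_, fun j hj1 hjm => ?_⟩
        · rw [hmt, hc, add_smul, one_smul]; abel
        · obtain rfl | hj2 := eq_or_lt_of_le hj1
          · exact ⟨s', hK, by simp [hc], by simp [testBit_bit]⟩
          · obtain ⟨u, huK, hu, hb⟩ := hj (j - 1) (by omega) (by omega)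
            refine ⟨u, huK, ?_, by simp [hb]⟩
            obtain ⟨i, rfl⟩ : ∃ i, j = i + 1 := ⟨j - 1, by omega⟩
            rw [hu, hc, add_tsub_cancel_right, add_smul, one_smul]; abel

theorem testBit_queenMask {k q p : ℕ} :
    (queenMask k q).testBit p ↔ ∃ d ∈ directions, (ray k (offset d) 7 q).testBit p := by
  simp [queenMask, directions, offset, or_assoc]

/-- The mask ignores the Black king as an obstacle. This is harmless in two cases: it stands off the
mask, hence off the path, or it is itself the target. -/
theorem queen_of_testBit {K Q b : Square} {p : ℕ} (h : (queenMask (pos K) (pos Q)).testBit p) :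
    ∃ t, pos t = p ∧ t ≠ K ∧ ((queenMask (pos K) (pos Q)).testBit (pos b) = false ∨ t = b →
      Config.Legal ⟨K, some Q, b⟩ (.queen t)) := by
  obtain ⟨d, hd, h⟩ := testBit_queenMask.1 h
  obtain ⟨t, ht, htK, m, hm1, hm7, hmt, hj⟩ := of_testBit_ray hd K 7 Q h
  refine ⟨t, ht, htK, fun hb => ⟨Q, rfl, ⟨d, hd, m, Finset.mem_Icc.2 ⟨hm1, hm7⟩, hmt, ?_⟩, htK⟩⟩
  intro j hj' u hu huc
  rw [Finset.mem_Ico] at hj'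
  obtain ⟨u', huK, hu', hbit⟩ := hj j hj'.1 hj'.2
  obtain rfl : u = u' := coord_inj.1 (huc.trans hu'.symm)
  obtain rfl | rfl : u = K ∨ u = b := by simpa using hu
  · exact huK rfl
  · rcases hb with hb | rfl
    · exact absurd (testBit_queenMask.2 ⟨d, hd, hbit⟩) (by simp [hb])
    -- The Black king on the target is `m` steps away, so it cannot also be met after `j < m` steps
    -- in the same nonzero direction.
    · have h0 : d ≠ 0 := by rintro rfl; revert hd; decide
      have : (j : ℤ) • d = (m : ℤ) • d := by
        simpa using add_left_cancel (huc.symm.trans hmt)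
      have := smul_left_injective ℤ h0 this
      omega

/-- Only this inclusion is needed: a mask that overestimates the unseen squares merely enlarges
beliefs. -/
theorem testBit_seenMask {K Q t : Square} (h : Unseen K Q t) :
    (seenMask (pos K) (pos Q)).testBit (pos t) = false := by
  by_contra hb
  refine h ?_
  simp only [Config.visible, Finset.mem_filter, Finset.mem_univ, true_and]
  simp only [seenMask, Nat.testBit_or, testBit_diff, Nat.testBit_and, Bool.not_eq_false,
    Bool.or_eq_true, Bool.and_eq_true, Bool.not_eq_true'] at hb
  rcases hb with hb | ⟨⟨-, hb⟩, hQ⟩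
  · obtain ⟨t', ht, -, hl⟩ := queen_of_testBit (b := t) hb
    obtain rfl := pos_inj.1 ht
    exact .inr (hl (.inr rfl))
  · refine .inl ⟨adjacent_of_testBit hb, ?_⟩
    rintro ⟨⟩
    have := (testBit_bit (pos Q) (pos Q)).2 rfl
    simp [this] at hQ

/-! ### Checking moves -/

/-- The squares on which the Black king can stand for all that White sees. -/
def unseenMask (k q : ℕ) : ℕ := diff board (seenMask k q ||| bit k ||| bit q)

theorem testBit_unseenMask {K Q t : Square} (h : Unseen K Q t) (hK : t ≠ K) (hQ : t ≠ Q) :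
    (unseenMask (pos K) (pos Q)).testBit (pos t) := by
  have h₁ : (bit (pos K)).testBit (pos t) = false := by
    rw [← Bool.not_eq_true, testBit_bit, pos_inj]; exact hK.symm
  have h₂ : (bit (pos Q)).testBit (pos t) = false := by
    rw [← Bool.not_eq_true, testBit_bit, pos_inj]; exact hQ.symm
  simp [unseenMask, testBit_diff, testBit_seenMask h, testBit_board, h₁, h₂]

/-- A move leads from the positions `k` and `q` of king and queen to `k'` and `q'`. -/
def canMove (k q k' q' : ℕ) : Bool :=
  q'.beq q && (diff (board &&& nbrs (bit k)) (bit q)).testBit k' ||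
    k'.beq k && (queenMask k q).testBit q'

/-- The squares from which the Black king can capture the White king, or an unprotected queen. -/
def danger (k q : ℕ) : ℕ :=
  nbrs (bit k) ||| bif (nbrs (bit k)).testBit q then 0 else nbrs (bit q)

theorem Adjacent.symm {s t : Square} (h : Adjacent s t) : Adjacent t s := by
  rw [adjacent_iff] at h ⊢
  omega

theorem Adjacent.testBit {s t : Square} (h : Adjacent s t) :
    (nbrs (bit (pos s))).testBit (pos t) :=
  testBit_nbrs h ((testBit_bit _ _).2 rfl)

theorem moveTo_of_canMove {K Q : Square} {k' q' : ℕ} (hKQ : K ≠ Q)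
    (h : canMove (pos K) (pos Q) k' q') :
    ∃ K' Q', pos K' = k' ∧ pos Q' = q' ∧ MoveTo K Q K' Q' := by
  simp only [canMove, Bool.or_eq_true, Bool.and_eq_true, Nat.beq_eq, testBit_diff,
    Nat.testBit_and, Bool.not_eq_true'] at h
  rcases h with ⟨rfl, ⟨hb, hn⟩, hq⟩ | ⟨rfl, h⟩
  · obtain ⟨K', rfl⟩ := exists_pos hb
    have hne : K' ≠ Q := by
      rintro rfl
      simp [(testBit_bit (pos K') (pos K')).2 rfl] at hq
    exact ⟨K', Q, rfl, rfl, hne, .king K', fun _ => rfl,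
      fun b _ => ⟨adjacent_of_testBit hn, by simpa using hne.symm⟩⟩
  · obtain ⟨Q', rfl, hne, -⟩ := queen_of_testBit (b := K) h
    refine ⟨K, Q', rfl, rfl, hne.symm, .queen Q', fun _ => rfl, fun b hb => ?_⟩
    obtain ⟨t, ht, -, hl⟩ := queen_of_testBit (b := b) h
    obtain rfl := pos_inj.1 ht
    refine hl (.inl ?_)
    have := testBit_seenMask hb
    rw [seenMask, Nat.testBit_or, Bool.or_eq_false_iff] at this
    exact this.1

theorem of_testBit_danger {K Q b : Square}
    (h : (danger (pos K) (pos Q)).testBit (pos b) = false) :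
    ¬ Adjacent b K ∧ (Adjacent b Q → Adjacent K Q) := by
  simp only [danger, Nat.testBit_or, Bool.or_eq_false_iff] at h
  refine ⟨fun hb => by simp [hb.symm.testBit] at h, fun hb => ?_⟩
  cases hp : (nbrs (bit (pos K))).testBit (pos Q) with
  | true => exact adjacent_of_testBit hp
  | false => simp [hp, hb.symm.testBit] at h

/-- The set of squares given by a mask. -/
def squares (a : ℕ) : Set Square := {s | a.testBit (pos s)}

theorem testBit_eq_false_of_and {a b s : ℕ} (h : (a &&& b).beq 0) (ha : a.testBit s) :
    b.testBit s = false := by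
  have := congrArg (·.testBit s) (Nat.eq_of_beq_eq_true h)
  simpa [ha] using this

theorem squares_subset {a b : ℕ} (h : (diff a b).beq 0) : squares a ⊆ squares b := by
  intro s hs
  have := congrArg (·.testBit (pos s)) (Nat.eq_of_beq_eq_true h)
  have hs : a.testBit (pos s) := hs
  show b.testBit (pos s)
  simpa [testBit_diff, hs] using this

/-! ### Checking plans -/

/-- An instruction for White: with the king on `k`, the queen on `q` and the Black king known to be
in the set `b`, move to `k'` and `q'`. -/
structure Instruction where
  k : ℕ
  q : ℕ
  k' : ℕ
  q' : ℕ
  b : ℕ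

/-- Some instruction in the list `l` applies to the positions `k` and `q` and the set `a`. -/
def covered (l : List Instruction) (k q a : ℕ) : Bool :=
  a.beq 0 || l.any fun e => e.k.beq k && e.q.beq q && (diff a e.b).beq 0

/-- The instruction `e` is safe and leads to situations covered by `l`. -/
def Instruction.check (l : List Instruction) (e : Instruction) : Bool :=
  canMove e.k e.q e.k' e.q' &&
  (e.b &&& danger e.k' e.q').beq 0 &&
  covered l e.k' e.q' (nbrs (diff e.b (seenMask e.k' e.q')) &&& unseenMask e.k' e.q') &&
  positions.all fun p => !(e.b &&& seenMask e.k' e.q').testBit p ||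
    covered l e.k' e.q' (nbrs (bit p) &&& unseenMask e.k' e.q')

/-- Every instruction leads to situations covered by later instructions. -/
def checkPlan : List Instruction → Bool
  | [] => true
  | e :: l => e.check l && checkPlan l

/-- White wins in the situations to which `e` applies. -/
def Instruction.Sound (Φ : Strategy → Strategy) (e : Instruction) : Prop :=
  ∀ K Q : Square, K ≠ Q → pos K = e.k → pos Q = e.q → BeliefWin Φ K Q (squares e.b)

theorem beliefWin_of_covered {Φ : Strategy → Strategy} {l : List Instruction}
    (hl : ∀ e ∈ l, e.Sound Φ) {K Q : Square} (hKQ : K ≠ Q) {a : ℕ}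
    (h : covered l (pos K) (pos Q) a) : BeliefWin Φ K Q (squares a) := by
  rw [covered, Bool.or_eq_true, List.any_eq_true] at h
  rcases h with h | ⟨e, he, h⟩
  · refine (BeliefWin.empty Φ K Q).mono fun s hs => ?_
    rw [Nat.eq_of_beq_eq_true h] at hs
    simp [squares] at hs
  · simp only [Bool.and_eq_true] at h
    exact (hl e he K Q hKQ (Nat.eq_of_beq_eq_true h.1.1).symm
      (Nat.eq_of_beq_eq_true h.1.2).symm).mono (squares_subset h.2)

/-- The two `covered` tests in `Instruction.check` supply the two branches of `BeliefWin.step`, the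
masks being upper bounds for the true beliefs. -/
theorem Instruction.sound_of_check {Φ : Strategy → Strategy} {done : View → Prop}
    (hΦ : HandsOver Φ done) (hq : ∀ v, done v → v.queen ≠ none) {l : List Instruction}
    (hl : ∀ e ∈ l, e.Sound Φ) {e : Instruction} (h : e.check l) : e.Sound Φ := by
  obtain ⟨k, q, k', q', b⟩ := e
  rintro K Q hKQ rfl rfl
  simp only [Instruction.check, Bool.and_eq_true, List.all_eq_true] at h
  obtain ⟨⟨⟨hm, hd⟩, hinv⟩, hvis⟩ := h
  obtain ⟨K', Q', rfl, rfl, move⟩ := moveTo_of_canMove hKQ hm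
  refine .of_unseen hΦ (.step hΦ hq move (fun s hs => hs.2.1) (fun s hs => ?_) (fun s hs => ?_)
    (S := {t | ∃ s ∈ squares b, Unseen K' Q' s ∧ Adjacent s t})
    (.of_unseen hΦ ((beliefWin_of_covered hl move.ne hinv).mono ?_)) ?_ fun s hs hv => ?_)
  · exact (of_testBit_danger (testBit_eq_false_of_and hd hs.1)).1
  · exact (of_testBit_danger (testBit_eq_false_of_and hd hs.1)).2
  · rintro t ⟨⟨s, hs, hu, hst⟩, hut, hK, hQ⟩
    have hs : b.testBit (pos s) := hs
    have := testBit_nbrs (a := diff b (seenMask (pos K') (pos Q'))) hst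
      (by simp [testBit_diff, hs, testBit_seenMask hu])
    simp [squares, testBit_unseenMask hut hK hQ, this]
  · rintro s hs hu t hst - -
    exact ⟨s, hs.1, hu, hst⟩
  · have hsb : b.testBit (pos s) := hs.1
    have := hvis (pos s) (pos_mem_positions s)
    rw [Bool.or_eq_true] at this
    -- Since masks are only known to bound the unseen squares, the case of a visible square outside
    -- `seenMask` must be treated: its neighbours are included in the belief of the unseen branch.
    rcases this with h | h
    · have hu : (seenMask (pos K') (pos Q')).testBit (pos s) = false := by simpa [hsb] using h
      refine .of_unseen hΦ ((beliefWin_of_covered hl move.ne hinv).mono ?_)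
      rintro t ⟨⟨hst, -⟩, hut, hK, hQ⟩
      have := testBit_nbrs (a := diff b (seenMask (pos K') (pos Q'))) hst
        (by simp [testBit_diff, hsb, hu])
      simp [squares, testBit_unseenMask hut hK hQ, this]
    · refine .of_unseen hΦ ((beliefWin_of_covered hl move.ne h).mono ?_)
      rintro t ⟨⟨hst, -⟩, hut, hK, hQ⟩
      simp [squares, testBit_unseenMask hut hK hQ, hst.testBit]

/-- Coverage by later instructions only makes the plan acyclic, so every play following it ends. -/
theorem sound_of_checkPlan {Φ : Strategy → Strategy} {done : View → Prop}
    (hΦ : HandsOver Φ done) (hq : ∀ v, done v → v.queen ≠ none) :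
    ∀ {l : List Instruction}, checkPlan l → ∀ e ∈ l, e.Sound Φ
  | [], _ => by simp
  | e :: l, h => by
    rw [checkPlan, Bool.and_eq_true] at h
    have hl := sound_of_checkPlan hΦ hq h.2
    exact List.forall_mem_cons.2 ⟨Instruction.sound_of_check hΦ hq hl h.1, hl⟩

/-! ### Checking the way to a corner -/

/-- The number of a square, from 0 to 63. -/
def number (s : Square) : ℕ := s.1.val + 8 * s.2.val

/-- The position of the square with a given number. -/
def posOf (i : ℕ) : ℕ := i % 8 + 1 + 10 * (i / 8 + 1)

theorem posOf_number (s : Square) : posOf (number s) = pos s := by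
  obtain ⟨⟨x, hx⟩, ⟨y, hy⟩⟩ := s
  simp only [posOf, number, pos]
  omega

theorem number_lt (s : Square) : number s < 64 := by
  obtain ⟨⟨x, hx⟩, ⟨y, hy⟩⟩ := s
  simp only [number]
  omega

theorem number_eq {s : Square} {i : ℕ} (h : pos s = posOf i) : number s = i := by
  rw [← posOf_number] at h
  simp only [posOf] at h
  omega

/-- The entry of a table for the king and the queen on the squares with numbers `k` and `q`. It
consists of a rank and of two moves. -/
def lookup (table : List ℕ) (k q : ℕ) : ℕ := table.getD k 0 >>> (20 * q)

/-- The rank in an entry of a table. If it is less than 15, then White need not know where the Black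
king is. -/
def rank (table : List ℕ) (k q : ℕ) : ℕ := lookup table k q &&& 15

/-- The king and the queen after a move in an entry of a table. -/
def after (table : List ℕ) (i k q : ℕ) : ℕ × ℕ :=
  let m := lookup table k q >>> i &&& 127
  bif m.ble 63 then (m, q) else (k, m - 64)

/-- The entry of a table for `k` and `q` gives a corner configuration, or moves to lower ranks such
that, wherever the Black king is, one of them is safe. -/
def checkTable (table : List ℕ) (k q : ℕ) : Bool :=
  k.beq q ||
  bif (rank table k q).beq 0 then
    [11, 18, 81, 88].contains (posOf k) && (nbrs (bit (posOf k))).testBit (posOf q)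
  else
    -- An entry takes 20 bits: the rank in bits 0 to 3, then two moves of 7 bits starting at bits 4
    -- and 11. Move codes up to 63 are king targets; queen targets are increased by 64.
    let a := after table 4 k q
    let b := after table 11 k q
    canMove (posOf k) (posOf q) (posOf a.1) (posOf a.2) &&
    canMove (posOf k) (posOf q) (posOf b.1) (posOf b.2) &&
    (rank table a.1 a.2).blt (rank table k q) && (rank table b.1 b.2).blt (rank table k q) &&
    ((rank table k q).beq 15 || a.1.beq b.1 && a.2.beq b.2) &&
    (unseenMask (posOf k) (posOf q) &&& danger (posOf a.1) (posOf a.2) &&&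
      danger (posOf b.1) (posOf b.2)).beq 0

theorem mem_corners {s : Square} (h : [11, 18, 81, 88].contains (pos s)) : s ∈ corners := by
  revert s; decide

/-- Strong induction on the rank. After a move nothing about the Black king is remembered, which
suffices because the new rank is below 15. -/
theorem beliefWin_of_checkTable {Φ : Strategy → Strategy} (hΦ : HandsOver Φ View.IsCorner)
    {table : List ℕ} (h : ∀ k < 64, ∀ q < 64, checkTable table k q) {K Q : Square} (hKQ : K ≠ Q)
    {B : Set Square} (hB : rank table (number K) (number Q) < 15 ∨ B.Subsingleton) :
    BeliefWin Φ K Q B := by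
  have hq : ∀ v : View, v.IsCorner → v.queen ≠ none := by
    rintro v ⟨-, q, hq, -⟩
    simp [hq]
  induction hr : rank table (number K) (number Q) using Nat.strong_induction_on
    generalizing K Q B with
  | _ r ih =>
  have hc := h _ (number_lt K) _ (number_lt Q)
  have hne : (number K).beq (number Q) = false := by
    rw [Bool.eq_false_iff, Ne, Nat.beq_eq]
    intro h
    exact hKQ (pos_inj.1 (by rw [← posOf_number, h, posOf_number]))
  simp only [checkTable, hne, Bool.false_or, hr, posOf_number] at hc
  cases h0 : r.beq 0 with
  | true =>
    simp only [h0, cond_true, Bool.and_eq_true] at hc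
    -- At rank 0 the hand-over takes place at once, so this strategy is never consulted.
    refine ⟨fun _ => .king K, ?_⟩
    rintro ⟨k, q, b⟩ ⟨rfl, rfl, -, hi⟩
    exact hΦ.wins _ _ hi ⟨mem_corners hc.1, Q, rfl, adjacent_of_testBit hc.2⟩
  | false =>
    simp only [h0, cond_false, Bool.and_eq_true, Nat.blt_eq] at hc
    obtain ⟨⟨⟨⟨⟨hma, hmb⟩, hra⟩, hrb⟩, h15⟩, hd⟩ := hc
    have hr15 : r ≤ 15 := by rw [← hr]; exact Nat.and_le_right
    have aux : ∀ p : ℕ × ℕ, canMove (pos K) (pos Q) (posOf p.1) (posOf p.2) →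
        rank table p.1 p.2 < r → ∀ A : Set Square, (∀ s ∈ A, Unseen K Q s) →
        (∀ s ∈ A, (danger (posOf p.1) (posOf p.2)).testBit (pos s) = false) →
        BeliefWin Φ K Q A := by
      intro p hm hp A hA hAd
      obtain ⟨K', Q', hK, hQ, hm⟩ := moveTo_of_canMove hKQ hm
      rw [← hK, ← hQ] at hAd
      rw [← number_eq hK, ← number_eq hQ] at hp
      exact .step_univ hΦ hq hm hA (fun s hs => (of_testBit_danger (hAd s hs)).1)
        (fun s hs => (of_testBit_danger (hAd s hs)).2)
        (ih _ hp hm.ne (.inl (by omega)) rfl)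
    have hsafe : ∀ s, Unseen K Q s ∧ s ≠ K ∧ s ≠ Q →
        (danger (posOf (after table 4 (number K) (number Q)).1)
          (posOf (after table 4 (number K) (number Q)).2)).testBit (pos s) = false ∨
        (danger (posOf (after table 11 (number K) (number Q)).1)
          (posOf (after table 11 (number K) (number Q)).2)).testBit (pos s) = false := by
      rintro s ⟨hu, hK, hQ⟩
      rw [Nat.land_assoc] at hd
      have := testBit_eq_false_of_and hd (testBit_unseenMask hu hK hQ)
      rwa [Nat.testBit_and, Bool.and_eq_false_iff] at this
    refine .of_unseen hΦ ?_
    rcases hB with hB | hB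
    · have h15' : r.beq 15 = false := by
        rw [Bool.eq_false_iff, Ne, Nat.beq_eq]; omega
      simp only [h15', Bool.false_or, Bool.and_eq_true, Nat.beq_eq] at h15
      refine aux _ hma hra _ (fun s hs => hs.2.1) fun s hs => ?_
      simpa [← h15.1, ← h15.2] using hsafe s hs.2
    -- The belief has at most one square, so whichever move is safe for that square can be chosen.
    · by_cases he : ∃ s ∈ B, Unseen K Q s ∧ s ≠ K ∧ s ≠ Q
      · obtain ⟨s, hs, hu⟩ := he
        rcases hsafe s hu with h | h
        · refine aux _ hma hra _ (fun s hs => hs.2.1) fun t ht => ?_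
          rwa [hB ht.1 hs]
        · refine aux _ hmb hrb _ (fun s hs => hs.2.1) fun t ht => ?_
          rwa [hB ht.1 hs]
      · exact (BeliefWin.empty Φ K Q).mono fun s hs => he ⟨s, hs⟩

/-! ### The plan and the table -/

/-- A winning plan that starts from every corner configuration. -/
def plan : List Instruction := [
  ⟨81, 82, 81, 72, 0x7c1ea769ba5e8fa7e800⟩, ⟨81, 71, 81, 72, 0x1f8001f87d1ec771bc5f000⟩,
  ⟨81, 72, 82, 72, 0x1f0001f07a9da6e97a3e800⟩, ⟨82, 72, 82, 73, 0x1f0001f07a9da6e97a3e800⟩,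
  ⟨82, 73, 83, 73, 0x1e0001e2751b65d8f67d800⟩, ⟨83, 73, 83, 74, 0x1e2001e2751b65d8f67d800⟩,
  ⟨83, 74, 84, 74, 0x1c2001c66a96c3b9ee7b800⟩, ⟨84, 74, 84, 75, 0x1c6001c66a96c3b9ee7b800⟩,
  ⟨11, 21, 11, 22, 0x17c6f1dc7b1f47e0007e000⟩, ⟨11, 12, 11, 22, 0x1fa3e97a6e9da7a9f000000⟩,
  ⟨84, 75, 85, 75, 0x1860018e558da771de77800⟩, ⟨11, 22, 12, 22, 0xfa5e9ba769ea7c0007c000⟩,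
  ⟨85, 75, 85, 76, 0x18e0018e558da771de77800⟩, ⟨12, 22, 12, 23, 0xfa5e9ba769ea7c0007c000⟩,
  ⟨85, 76, 86, 76, 0x10e0011e2b9b66e9bc6f800⟩, ⟨12, 23, 13, 23, 0x1f63d9766d9d47880078000⟩,
  ⟨86, 76, 86, 77, 0x11e0011e2b9b66e9bc6f800⟩, ⟨13, 23, 13, 24, 0x1f63d9766d9d47880078800⟩,
  ⟨88, 87, 88, 77, 0xf95e5b9765e97c5f800⟩, ⟨88, 78, 88, 77, 0x7e0007e2f8de3b8f63e800⟩,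
  ⟨86, 77, 87, 77, 0x1e0003e5796e5d97a5f000⟩, ⟨13, 24, 14, 24, 0x1ee7b8ee5b1aa7180070800⟩,
  ⟨88, 77, 78, 77, 0x3e0003e5796e5d97a5f000⟩, ⟨87, 77, 78, 77, 0x3e0003e5796e5d97a5f000⟩,
  ⟨14, 24, 14, 25, 0x1ee7b8ee5b1aa7180071800⟩, ⟨78, 77, 78, 67, 0x3e0003e5796e5d97a5f000⟩,
  ⟨14, 25, 15, 25, 0x1de779dc369566380061800⟩, ⟨78, 67, 68, 67, 0x5e0f8000f95e5b9765e800⟩,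
  ⟨15, 25, 15, 26, 0x1de779dc369566380063800⟩, ⟨68, 67, 68, 57, 0x15e0f8000f95e5b9765e800⟩,
  ⟨15, 26, 16, 26, 0x1be6f1ba6d8ae4780043800⟩, ⟨68, 57, 58, 57, 0x16e1783e0003e5796e5d800⟩,
  ⟨16, 26, 16, 27, 0x1be6f1ba6d8ae4780047800⟩, ⟨58, 57, 58, 47, 0x16e5783e0003e5796e5d800⟩,
  ⟨18, 28, 18, 27, 0xfa3d8ee378be1f8001f800⟩, ⟨18, 17, 18, 27, 0x17e5f17a5d96e5783e00000⟩,
  ⟨16, 27, 17, 27, 0x17c5e9765b95e0f80007800⟩, ⟨58, 47, 48, 47, 0x1765b85e0f8000f95e5b800⟩,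
  ⟨18, 27, 28, 27, 0x17c5e9765b95e0f8000f800⟩, ⟨17, 27, 28, 27, 0x17c5e9765b95e0f8000f800⟩,
  ⟨48, 47, 48, 37, 0x1765b95e0f8000f95e5b800⟩, ⟨28, 27, 28, 37, 0x17c5e9765b95e0f8000f800⟩,
  ⟨48, 37, 38, 37, 0x17a5d96e1783e0003e57800⟩, ⟨28, 37, 38, 37, 0x17a5d96e5783e0003e17800⟩,
  ⟨38, 37, 38, 48, 0x17a5d96e5783e0003e57800⟩, ⟨38, 48, 38, 47, 0xee378be1f8001f83e77800⟩,
  ⟨38, 47, 38, 45, 0x14050140000000000000000⟩, ⟨38, 47, 38, 37, 0x761b85e0f8000f85e5b800⟩,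
  ⟨38, 45, 38, 27, 0xc030040600000000000000⟩, ⟨38, 37, 38, 17, 0x7a1d86e1783e0003e07800⟩,
  ⟨38, 27, 38, 47, 0x140500400000000000⟩, ⟨38, 47, 38, 27, 0x58040080000800000000⟩,
  ⟨38, 17, 38, 27, 0x7e1f07a1d86e1783e00000⟩, ⟨38, 27, 48, 27, 0x17c1e9761b85e0f80000000⟩,
  ⟨48, 27, 58, 27, 0x7c5e8761b85e0f80000000⟩, ⟨58, 27, 58, 16, 0x17c1e8761b85e0f80000000⟩,
  ⟨58, 16, 57, 16, 0xbe6f83c0e8362b81e00000⟩, ⟨57, 16, 57, 46, 0x1be6f83c0e8360b91e00000⟩,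
  ⟨57, 46, 57, 26, 0x1ba6d82e078000780e05800⟩, ⟨57, 26, 57, 15, 0x1be6f03a0d82e0780003800⟩,
  ⟨57, 26, 56, 26, 0x700007000⟩, ⟨57, 15, 56, 15, 0x1de7781e0701a0580e00000⟩,
  ⟨56, 15, 56, 65, 0x1de7791e0701a0580e00000⟩, ⟨38, 27, 38, 67, 0xe0000e000⟩,
  ⟨57, 46, 57, 66, 0x60280c000⟩, ⟨57, 15, 56, 15, 0x40101400000000⟩,
  ⟨56, 65, 56, 55, 0x15663800438160681c07800⟩, ⟨38, 67, 38, 66, 0x5c1b0741e000⟩,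
  ⟨56, 55, 56, 65, 0xda5590e0010e0581a07000⟩, ⟨38, 66, 47, 66, 0x782e0d83a0f000⟩,
  ⟨56, 15, 56, 45, 0x18060180408800000⟩, ⟨47, 66, 47, 75, 0x782e0d83a0f000⟩,
  ⟨56, 65, 56, 55, 0x14663800438166681c07800⟩, ⟨47, 75, 56, 75, 0xe0581a0701e07800⟩,
  ⟨57, 66, 57, 56, 0x2c0d0380f000⟩, ⟨56, 75, 56, 45, 0xe0581a0701e07800⟩,
  ⟨56, 55, 56, 45, 0xca5190e0010e0589a07000⟩, ⟨57, 56, 47, 56, 0x1e0b8360e800⟩,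
  ⟨56, 45, 55, 45, 0x1d476906438000381606800⟩, ⟨56, 26, 55, 26, 0xe0780007800⟩,
  ⟨38, 66, 47, 66, 0x802028000⟩, ⟨55, 45, 55, 18, 0x1fc3e906638000381606800⟩,
  ⟨47, 66, 47, 65, 0x200c1b04c000⟩, ⟨47, 56, 47, 65, 0x1e0b8360e800⟩,
  ⟨55, 18, 55, 27, 0xfc3e8862388e0f83e00000⟩, ⟨47, 75, 46, 75, 0x100405000000⟩,
  ⟨47, 65, 46, 65, 0x3816069dc77800⟩, ⟨38, 27, 38, 47, 0x700007000⟩,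
  ⟨55, 27, 55, 38, 0x14050100400000000000000⟩, ⟨47, 75, 46, 75, 0x405014000⟩,
  ⟨46, 75, 46, 74, 0x40180609836000⟩, ⟨46, 65, 46, 74, 0x3816069dc77800⟩,
  ⟨38, 47, 37, 47, 0xf81e0b800⟩, ⟨55, 38, 55, 37, 0xe038080200000000000000⟩,
  ⟨55, 27, 55, 37, 0x7c1e8060380e0f80000000⟩, ⟨46, 75, 46, 64, 0x18060d836000⟩,
  ⟨46, 74, 45, 74, 0x60280c039ee7b800⟩, ⟨37, 47, 37, 48, 0xf81e1b800⟩,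
  ⟨55, 37, 55, 36, 0x7e1f80e0380e0000000000⟩, ⟨46, 64, 45, 64, 0x1008431ec7b000⟩,
  ⟨45, 74, 45, 65, 0x60280c239ee7b800⟩, ⟨37, 48, 37, 46, 0xf83e3f800⟩,
  ⟨55, 36, 55, 54, 0x3c0e8060380e0000000000⟩, ⟨55, 26, 55, 17, 0x180e0780007800⟩,
  ⟨45, 65, 45, 68, 0x3906229fc7f800⟩, ⟨45, 64, 45, 68, 0x198a430ee7b800⟩,
  ⟨37, 46, 37, 55, 0x782e6d800⟩, ⟨56, 45, 56, 55, 0xc06816030000000000000⟩,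
  ⟨55, 54, 55, 64, 0x6c0a806000060280000000⟩, ⟨55, 17, 55, 27, 0xa0180e0783e00000⟩,
  ⟨45, 68, 45, 67, 0x388e238ee3d800⟩, ⟨37, 55, 36, 55, 0xe0581a77000⟩,
  ⟨56, 55, 45, 55, 0x1a0580e0000e0000000000⟩, ⟨55, 64, 55, 74, 0x2118000180a0300e00000⟩,
  ⟨45, 67, 45, 56, 0x380e0387e1f800⟩, ⟨55, 74, 46, 74, 0xc000080000000000000000⟩,
  ⟨55, 27, 55, 37, 0x68060380e0f80000000⟩, ⟨36, 55, 36, 64, 0xe0581a77000⟩,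
  ⟨55, 37, 55, 67, 0x3e0f80e0380e0000000000⟩, ⟨45, 65, 45, 76, 0x3800038000000000000⟩,
  ⟨36, 64, 35, 64, 0x180a0300e7b800⟩, ⟨55, 67, 55, 64, 0x5e0f8000380e0380000000⟩,
  ⟨55, 27, 55, 37, 0xf8000f800⟩, ⟨45, 76, 45, 54, 0x1e0001e038060000000000⟩,
  ⟨45, 56, 45, 36, 0xe0383e0f800⟩, ⟨45, 56, 45, 54, 0x1e0000e0000000000⟩,
  ⟨45, 55, 45, 54, 0x1a0580e0000e0180000000⟩, ⟨35, 64, 35, 24, 0x180a0308e7b800⟩,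
  ⟨55, 74, 45, 74, 0x6000060280c0380e03800⟩, ⟨55, 64, 45, 64, 0xa018000180a0300e00000⟩,
  ⟨55, 37, 45, 37, 0xe0003e17800⟩, ⟨45, 54, 45, 44, 0xc02806000060280c00000⟩,
  ⟨45, 36, 45, 37, 0x380e0001e0b800⟩, ⟨35, 24, 35, 14, 0xe0300a0180071800⟩,
  ⟨46, 74, 46, 64, 0x1c000140400000000000000⟩, ⟨45, 74, 45, 34, 0x6000060280c0380e03800⟩,
  ⟨45, 64, 45, 34, 0xa018000180a0300e03800⟩, ⟨45, 44, 45, 34, 0xe0300a018000180a03000⟩,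
  ⟨45, 37, 45, 34, 0xe0380e0003e17800⟩, ⟨35, 14, 35, 24, 0x380e0380c0298600000⟩,
  ⟨55, 37, 55, 46, 0x14050100400000000000000⟩, ⟨45, 34, 45, 44, 0xe0380c02806000060a800⟩,
  ⟨38, 27, 38, 54, 0x14050140000000000000000⟩, ⟨35, 24, 45, 24, 0xe0380e0300a0180000000⟩,
  ⟨45, 44, 45, 34, 0xe0300a018000182811000⟩, ⟨45, 24, 45, 34, 0xe0380e0300a0180000000⟩,
  ⟨38, 27, 38, 54, 0x380003800⟩, ⟨45, 34, 55, 34, 0xe0380c028060000000000⟩,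
  ⟨38, 54, 37, 54, 0x160681c0000000000000000⟩, ⟨45, 67, 45, 56, 0x1004014050000⟩,
  ⟨37, 54, 46, 54, 0x160681c0000000000000000⟩, ⟨55, 34, 55, 23, 0xe0380c028060000000000⟩,
  ⟨46, 64, 46, 63, 0x1a070000401000000000000⟩, ⟨46, 54, 46, 63, 0x160681c0000000000000000⟩,
  ⟨55, 23, 55, 33, 0x1405004010000000000000⟩, ⟨46, 63, 56, 63, 0x1d078000401004000000000⟩,
  ⟨56, 63, 56, 67, 0x1d078000401006010000000⟩, ⟨55, 33, 54, 33, 0x360d806010020000000000⟩,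
  ⟨56, 67, 56, 85, 0x1005014000000⟩, ⟨56, 55, 56, 85, 0x100500c000000⟩,
  ⟨56, 45, 56, 65, 0x400006014030000⟩, ⟨54, 33, 54, 63, 0x761d806010020000000000⟩,
  ⟨56, 85, 56, 75, 0x100701c070000⟩, ⟨56, 65, 56, 75, 0x100701c070000⟩,
  ⟨54, 63, 54, 64, 0xd438800008000000000000⟩, ⟨45, 34, 44, 34, 0x60000600000⟩,
  ⟨56, 75, 56, 31, 0x400006000000000⟩, ⟨56, 75, 56, 31, 0x701c070000⟩,
  ⟨45, 56, 45, 36, 0x1002018000000⟩, ⟨56, 31, 46, 31, 0x100001e078000⟩,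
  ⟨45, 36, 55, 36, 0x200000000020000⟩, ⟨38, 54, 27, 54, 0x60280c03800⟩,
  ⟨55, 46, 55, 66, 0x60080400000000000000⟩, ⟨55, 36, 65, 36, 0x180001000010000000⟩,
  ⟨65, 36, 65, 37, 0x60180200000000020000⟩, ⟨55, 66, 45, 66, 0x8000000000800000000000⟩,
  ⟨54, 64, 54, 63, 0x1aa71000010020000000000⟩, ⟨46, 31, 46, 37, 0x40000001f07c000⟩,
  ⟨45, 44, 35, 44, 0x180a03000⟩, ⟨38, 37, 38, 31, 0x3014000⟩, ⟨65, 37, 56, 37, 0x50000⟩,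
  ⟨46, 37, 56, 37, 0x100000000003856000⟩, ⟨45, 66, 35, 66, 0x40000400006000000000⟩,
  ⟨35, 44, 35, 45, 0x180a03000⟩, ⟨56, 37, 56, 38, 0x40000400000003c17000⟩,
  ⟨38, 31, 47, 31, 0x783c000⟩, ⟨35, 66, 35, 67, 0x8000000000806018000000⟩,
  ⟨27, 54, 36, 54, 0x60280c03800⟩, ⟨56, 67, 46, 67, 0x1580e000001004010040000⟩,
  ⟨56, 38, 46, 38, 0x7e2f800⟩, ⟨55, 37, 55, 34, 0x701c000000000000000000⟩,
  ⟨54, 63, 54, 61, 0x1d478000000000000000000⟩, ⟨47, 31, 47, 38, 0x1f87d000⟩,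
  ⟨45, 56, 45, 36, 0x201a068000⟩, ⟨45, 54, 55, 54, 0x280a000000000000000000⟩,
  ⟨36, 54, 35, 54, 0x60280c03800⟩, ⟨35, 67, 46, 67, 0x14000000000000000000000⟩,
  ⟨35, 45, 35, 36, 0x380606800⟩, ⟨56, 37, 56, 33, 0x2000000⟩,
  ⟨55, 54, 55, 64, 0x6c0a004000000000000000⟩, ⟨55, 34, 55, 64, 0xe83a008000000000000000⟩,
  ⟨54, 61, 55, 61, 0x1f07e000000000000000000⟩, ⟨47, 38, 46, 38, 0x7e2f800⟩,
  ⟨46, 67, 46, 68, 0x5c0f000001004010040000⟩, ⟨45, 36, 45, 34, 0x11028000⟩,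
  ⟨35, 54, 35, 63, 0x60280c03800⟩, ⟨35, 36, 35, 63, 0xe0380e03800⟩,
  ⟨55, 64, 56, 64, 0x1a071000000000000000000⟩, ⟨55, 61, 56, 61, 0x1f47e000000000000000000⟩,
  ⟨55, 46, 55, 66, 0xa028080000000000000000⟩, ⟨55, 36, 55, 66, 0xa028080000000000000000⟩,
  ⟨46, 68, 56, 68, 0xbe1f800000000000000000⟩, ⟨46, 38, 46, 35, 0x7e2f800⟩, ⟨45, 34, 46, 34, 0xa000⟩,
  ⟨35, 63, 34, 63, 0x100405000⟩, ⟨56, 68, 56, 65, 0xbe1f800000000000000000⟩,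
  ⟨56, 64, 56, 65, 0x1aa70800000000000000000⟩, ⟨56, 61, 56, 65, 0x1f47e000000000000000000⟩,
  ⟨55, 66, 55, 65, 0x2044000000000000000000⟩, ⟨55, 64, 54, 64, 0x1800018000000000000⟩,
  ⟨46, 35, 45, 35, 0x14000⟩, ⟨45, 34, 45, 35, 0x602800⟩, ⟨34, 63, 34, 23, 0x40180609800⟩,
  ⟨56, 65, 56, 67, 0x15663800000000000000000⟩, ⟨54, 64, 54, 63, 0xa01800018020000000000⟩,
  ⟨46, 34, 46, 36, 0x4400000⟩, ⟨45, 35, 45, 36, 0x8e01800⟩, ⟨44, 34, 44, 33, 0x8060000602800⟩,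
  ⟨38, 45, 38, 56, 0x18020100000000000000000⟩, ⟨34, 23, 35, 23, 0x18040080010800⟩,
  ⟨56, 67, 56, 66, 0x1e0f800000000000000000⟩, ⟨56, 65, 56, 66, 0x1603800000000000000000⟩,
  ⟨55, 65, 55, 66, 0x11022000000000000000000⟩, ⟨55, 23, 44, 23, 0x601806018040080000000⟩,
  ⟨54, 63, 44, 63, 0x400000000040000000000⟩, ⟨54, 63, 54, 73, 0x8040180000000⟩,
  ⟨46, 36, 46, 35, 0xa03800⟩, ⟨45, 36, 45, 35, 0x1e03800⟩, ⟨44, 33, 34, 33, 0x201000⟩,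
  ⟨38, 56, 47, 56, 0x18020100000000000000000⟩, ⟨35, 63, 35, 73, 0x8040180601800⟩,
  ⟨35, 36, 44, 36, 0x80a000⟩, ⟨35, 24, 34, 24, 0x180001800⟩, ⟨35, 23, 35, 13, 0x6018040080028000⟩,
  ⟨56, 66, 55, 66, 0x2e07800000000000000000⟩, ⟨54, 73, 44, 73, 0x2010060180600000⟩,
  ⟨46, 35, 55, 35, 0xe05800⟩, ⟨44, 63, 44, 73, 0x800008000180000000⟩,
  ⟨44, 33, 34, 33, 0x6010020000005000⟩, ⟨44, 23, 44, 13, 0x601806018040080000000⟩,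
  ⟨35, 73, 44, 73, 0x2010060180601800⟩, ⟨35, 13, 44, 13, 0x1806018060100200000⟩,
  ⟨34, 24, 34, 33, 0x20180001800⟩, ⟨57, 46, 57, 66, 0x4008060000⟩,
  ⟨55, 66, 55, 65, 0x2e07800000000000000000⟩, ⟨55, 64, 66, 64, 0x2a01800000000000000000⟩,
  ⟨44, 73, 44, 43, 0x2010060180601800⟩, ⟨44, 13, 44, 43, 0x601806018060100200000⟩,
  ⟨35, 67, 46, 67, 0x4010050000⟩, ⟨34, 33, 34, 43, 0x1806010020000200000⟩,
  ⟨65, 37, 66, 37, 0x14040100000000000000000⟩, ⟨57, 66, 57, 33, 0x6018060000⟩,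
  ⟨56, 33, 46, 33, 0x4014000⟩, ⟨55, 65, 44, 65, 0x1603800000000000000000⟩,
  ⟨55, 35, 44, 35, 0xe05800⟩, ⟨46, 67, 46, 23, 0x1004016048000⟩, ⟨45, 36, 56, 36, 0x1000010000000⟩,
  ⟨45, 35, 44, 35, 0xe05800⟩, ⟨45, 34, 55, 34, 0x1c068000⟩, ⟨44, 43, 33, 43, 0x8000080000000⟩,
  ⟨44, 36, 44, 35, 0x1c03000⟩, ⟨34, 43, 33, 43, 0x601804008000080000000⟩,
  ⟨66, 64, 65, 64, 0xa01800000000000000000⟩, ⟨57, 33, 46, 33, 0x1c070000⟩,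
  ⟨55, 34, 46, 34, 0x1c068000⟩, ⟨46, 23, 46, 78, 0x401004000070000⟩,
  ⟨44, 65, 53, 65, 0x1603800000000000000000⟩, ⟨44, 35, 43, 35, 0xe05800⟩,
  ⟨33, 43, 44, 43, 0x601804008000000000000⟩, ⟨66, 37, 66, 38, 0x12040100400000000000000⟩,
  ⟨56, 36, 56, 35, 0x20000⟩, ⟨53, 65, 53, 76, 0x1603800000000000000000⟩,
  ⟨47, 56, 47, 65, 0x18020100000000000000000⟩, ⟨46, 78, 46, 23, 0xe038000⟩,
  ⟨46, 34, 46, 23, 0x1c068000⟩, ⟨46, 33, 46, 23, 0x1e070000⟩,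
  ⟨44, 43, 54, 43, 0x601804008000000000000⟩, ⟨43, 35, 43, 26, 0xe05800⟩,
  ⟨35, 24, 35, 42, 0x6000070000⟩, ⟨66, 38, 66, 78, 0x5000000000000000000000⟩,
  ⟨65, 64, 54, 64, 0xa01800000000000000000⟩, ⟨54, 43, 54, 53, 0x601804008000000000000⟩,
  ⟨53, 76, 53, 85, 0xe00002000000000000000⟩, ⟨47, 65, 58, 65, 0x14060000000000000000000⟩,
  ⟨46, 23, 46, 14, 0x4000070000⟩, ⟨44, 43, 34, 43, 0x80401800⟩, ⟨43, 26, 43, 15, 0x80003800⟩,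
  ⟨35, 42, 35, 46, 0x6018070000⟩, ⟨66, 78, 65, 78, 0x2800000000000000000000⟩,
  ⟨58, 65, 57, 65, 0x14060000000000000000000⟩, ⟨56, 65, 57, 65, 0x14060000000000000000000⟩,
  ⟨56, 38, 57, 38, 0x8020000000000000000000⟩, ⟨56, 35, 47, 35, 0x18050000⟩,
  ⟨56, 31, 56, 64, 0x100001000000000000⟩, ⟨55, 65, 64, 65, 0x5000000000000000000000⟩,
  ⟨55, 46, 55, 66, 0x18060080000000000000000⟩, ⟨55, 27, 56, 27, 0x100401000000000000⟩,
  ⟨54, 64, 54, 63, 0xa01800000000000000000⟩, ⟨54, 53, 54, 63, 0x601002000000000000000⟩,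
  ⟨54, 53, 43, 53, 0x2000020000000000⟩, ⟨53, 85, 53, 63, 0x3800000000000000000⟩,
  ⟨46, 68, 46, 48, 0x8020000⟩, ⟨46, 35, 46, 36, 0x18050000⟩, ⟨46, 14, 46, 36, 0x100001c000000⟩,
  ⟨45, 36, 35, 36, 0x10020000⟩, ⟨43, 15, 43, 33, 0x20000e00000⟩, ⟨35, 46, 25, 46, 0x4008060000⟩,
  ⟨35, 13, 25, 13, 0x18000000⟩, ⟨34, 43, 24, 43, 0x80401800⟩,
  ⟨65, 78, 65, 74, 0x5400000000000000000000⟩, ⟨65, 37, 66, 37, 0x10040100400000000000000⟩,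
  ⟨64, 65, 75, 65, 0x20000000000000000000⟩, ⟨57, 65, 57, 74, 0x14060000000000000000000⟩,
  ⟨57, 38, 57, 74, 0xc030000000000000000000⟩, ⟨56, 64, 56, 67, 0x60000400004000000000⟩,
  ⟨56, 27, 56, 47, 0x40100401000000000000⟩, ⟨55, 66, 56, 66, 0x8040000400000000000000⟩,
  ⟨54, 63, 53, 63, 0x800008000000000000⟩, ⟨54, 63, 64, 63, 0x1400800000000000000000⟩,
  ⟨53, 85, 53, 63, 0x1800008000000000000⟩, ⟨53, 76, 64, 76, 0x1e00000000000000000000⟩,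
  ⟨53, 63, 64, 63, 0x1400000000000000000000⟩, ⟨47, 35, 47, 24, 0x18050000⟩,
  ⟨46, 48, 35, 48, 0x8030000⟩, ⟨46, 36, 46, 37, 0x10020000⟩, ⟨46, 23, 35, 23, 0x78000⟩,
  ⟨43, 53, 52, 53, 0x1000000000000000000⟩, ⟨43, 33, 43, 32, 0x201000⟩, ⟨43, 26, 33, 26, 0x7800⟩,
  ⟨35, 67, 36, 67, 0x1004010040000⟩, ⟨25, 46, 25, 57, 0x4008060000⟩, ⟨25, 13, 25, 57, 0x6018000000⟩,
  ⟨24, 43, 24, 52, 0x80401800⟩, ⟨75, 65, 75, 76, 0x10040000000000000000000⟩,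
  ⟨66, 37, 66, 57, 0x10040100400000000000000⟩, ⟨65, 74, 65, 73, 0x8200000000000000000000⟩,
  ⟨64, 76, 64, 73, 0x1e00000000000000000000⟩, ⟨64, 63, 64, 73, 0x400800000000000000000⟩,
  ⟨57, 74, 67, 74, 0x1c000000000000000000000⟩, ⟨56, 67, 46, 67, 0x1000010000000⟩,
  ⟨56, 66, 56, 67, 0x8040000000000000000000⟩, ⟨56, 47, 56, 67, 0x10040100000000000000000⟩,
  ⟨53, 63, 53, 62, 0x400800000000000000000⟩, ⟨52, 53, 52, 62, 0x600000000000000000000⟩,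
  ⟨47, 24, 37, 24, 0x70000⟩, ⟨46, 36, 35, 36, 0x28000⟩, ⟨43, 33, 34, 33, 0x5000⟩,
  ⟨38, 47, 38, 87, 0x100000000000000000⟩, ⟨36, 67, 36, 47, 0x1004010040000⟩,
  ⟨35, 48, 35, 26, 0x8030000⟩, ⟨35, 46, 35, 26, 0x8028000⟩, ⟨35, 36, 35, 26, 0x10020000⟩,
  ⟨35, 23, 35, 26, 0x78000⟩, ⟨34, 33, 34, 23, 0x201000⟩, ⟨33, 26, 33, 16, 0x7800⟩,
  ⟨25, 57, 26, 57, 0x4010040000⟩, ⟨24, 52, 23, 52, 0x80200800⟩,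
  ⟨75, 76, 66, 76, 0x10000100000000000000000⟩, ⟨67, 74, 67, 84, 0x1c000000000000000000000⟩,
  ⟨66, 57, 66, 77, 0x10040000000000000000000⟩, ⟨66, 38, 66, 68, 0x8000000000000000000000⟩,
  ⟨65, 73, 65, 76, 0x14000000000000000000000⟩, ⟨64, 73, 64, 75, 0x2000000000000000000000⟩,
  ⟨64, 73, 63, 73, 0x200002000000000000000⟩, ⟨56, 67, 66, 67, 0x14000000000000000000000⟩,
  ⟨53, 62, 63, 62, 0xa00000000000000000000⟩, ⟨52, 62, 63, 62, 0xa00000000000000000000⟩,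
  ⟨46, 67, 46, 37, 0x4000040000⟩, ⟨46, 37, 36, 37, 0x50000⟩,
  ⟨44, 73, 43, 73, 0x200002000000000000000⟩, ⟨43, 33, 32, 33, 0x1000⟩, ⟨43, 32, 33, 32, 0x2800⟩,
  ⟨38, 87, 38, 77, 0x400000000000000⟩, ⟨37, 24, 37, 14, 0x70000⟩, ⟨36, 47, 36, 27, 0x10040000⟩,
  ⟨35, 36, 26, 36, 0x10000000⟩, ⟨35, 26, 35, 24, 0x4000⟩, ⟨35, 26, 36, 26, 0x4000040000⟩,
  ⟨34, 33, 23, 33, 0x200000⟩, ⟨34, 23, 43, 23, 0x80000800⟩, ⟨33, 16, 33, 13, 0x200000⟩,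
  ⟨26, 57, 26, 58, 0x4010040000⟩, ⟨23, 52, 23, 51, 0x80200800⟩]

/-- The safe ways to a corner configuration. -/
def cornerTable : List ℕ := [
  0x24c91244812288f2c44f2d81f0081420c112448120c1124c91244812208f2b81f0081420c11244812381f20c1124c91244810401f0081420c112448123c3f2301f20c1124c91244810081420c11244812208f2188f0401f20c1124c912448120c11244810408404084040840408420c1124c9120c1124481244812448124481244812448120c11000000000020c1120c1120c1120c1120c1120c110000000000,
  0x00002000022288f2c02f010252142300002000020000200002000020402f0102521423000020000221423000020000200002010252142300002000022382f214230000200002000022142300002000022208f0402f214230000200002000020000200002040840408404084214230000200002000020000200002000020000200002000020000200001000010000200002000020000200002000020000024482,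
  0x24c933fff40483f0183725cb4254a424c930081320c1424c930181f0183725cb4254a424c930081325cb420c1424c930183725cb4254a424c930081321c3525cb420c1424c9325cb4254a424c93008130483f21c3525cb420c1424c93254a424c9300813050a5050a5050a525cb420c1424c9324c930081324c9324c9324c9324c9324c9324c93008120081221c3521c3521c3525cb4254a40000024c9300813,
  0x0582f0202f02046264c625cb6254a5010240602f254a53bf7602046264c625cb6254a5010240202f21426254a502046264c625cb6254a501024264c6264c621426254a5264c625cb6254a50102425cb622447264c602046254a525cb6254a501024254a5058b7058b70204621426254a5254a50102421426254a50204402045254a5254a501024010230102322447020450204625cb600000254a50102401024,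
  0x0585f0285426cd5264c625cb6018360283f0605f0283f0285426cd5264c625cb6018363870626cd525cb60285426cd5264c625cb60183626cd522c56264c60285426cd5264c625cb626cd522c5625cb626cd50285426cd5264c626cd50183625cb621c3722c560285426cd526cd522c5601836060c7060c702853028530285426cd526cd5018350183426cd5028540285426cd50000025cb6018360183521c37,
  0x03063274e326cd4264c4020470704f3c784274e303063274e326cd4264c4020470304f274e32346403063274e326cd4264c402047274e323464264c403063274e326cd4264c4274e323464264c42244503063274e326cd4274e323464264c4224450684f03063274e3274e323464264c4068d5068d5068d50306203062274e3274e3274e3274e3274e3274e303063274e300000264c4264c421c352244522445,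
  0x038720387222c53028552d85f210ef0387203872038720387222c53028550705f038720387203872038720387222c530285503872038720387222c53038720387222c5303872038720387222c532005f038720387203872038720387222c530705f200df0387203872038720387222c53070e4070e4070e40387103871038720387203872038720387203872274e200000038720387203872038720387203872,
  0x27cf123461030642e06f2dc3f210ef27cf1274e127cf123461030642806f218ef27cf1274e12346127cf123461030640786f27cf1274e1234612006f27cf1234610306427cf1274e1234612086f2240f27cf12346127cf1274e1234610786f208ef200ef274e123461274e123461078f4078f4078f4078f4000000000023461274e1274e1274e1274e1274e10000000000234612346123461234612346123461,
  0x0000200002285032210f2d81f008140000200002000020000200002285030801f0081400002000022381f000020000200002285030081400002000022190f0801f0000200002000022850300002000020810508105081050000200002000020000200002285032850328503285030000200002000020000200002000020000200002000020000200001000000000200002000020000200002000020000120c12,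
  0x0000200002285030802f01025214230000200002000020000200002285030102521423000020000221423000020000200002285032142300002000020802f214230000200002000022142300002000020810508105214230000200002000020000200002285032850328503214230000200002000020000200002000020000200002000020000200000000010000200002000020000200002000020000120c12,
  0x24c9328d140483f01837010252952424c93008133fff424c9328d1401837010252952424c9300813214240102524c9328d14010252952424c930081321c35214240102524c9328d142952424c93008130912721c35214240102524c9328d1424c930081328d1428d1428d142142428d1424c9324c9300813010240102401024010240102400000008120081220c1420c1420c1420c1420c1424c9324c9300813,
  0x295263fff7020460183729d36254a5010240602f254a529526020460183729d36254a5010242a54701837254a5020460183729d36254a50102429d3621c3601837254a52952629d36254a501024295262244721c3602046254a529526254a501024254a529526295260204629526254a5254a50102421426018360204402045018360000001024010230102321426020450204621426254a5254a50102401024,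
  0x0585f0285426cd52a54602047018363c7872ad5629d370285426cd52a54602047018362ad5626cd52a5460285426cd52a546020470183626cd5020472ad560285426cd52a5462ad5626cd5020472244626cd50285426cd52a54626cd5018362244621c3722c560285426cd526cd52a546018362a5462a5460285302853028540000001836018350183402046028540285426cd526cd522446018360183522446,
  0x03063274e32ad5402855020470704f2b564274e303063274e32ad5402855020472b564274e33c78403063274e32ad54028552b564274e30285522c5403063274e32ad542b564274e30285522c542244503063274e32ad54274e30285522c54224450a95703063274e3274e32ad5422c542ad542ad542ad54030620306200000028540285402854028540285403063274e3274e322c5422c5422c5422c5422c54,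
  0x038720387222c53028550b05f2bd730387203872038720387222c53028552bd73038720387203872038720387222c532bd7303872038720387222c53038720387222c5303872038720387222c530b05f038720387203872038720387222c530b9750b9750387203872038720387222c532ad532ad532ad5303871000000387203872038720387203872038722346203871038720387203872038720387203872,
  0x0387203872030642c06f2196f2bd7303872038720387203872030640b86f2bd730387203872038720387203872030642bd730387203872038722006f03872038722bd730387203872038720b86f2016f03872038720387203872038720b9750b9750b975038720387203872038722b5632b5632b5632b56300000038710387203872038720387203872038722346203871038720387203872038720387203872,
  0x24c93244842cd942c5850c09f0891524c932c5853fff424c93244842cd942c5850891524c932c5850c09f0888f24c93244842cd940891524c932c5850c1870c1870c18724c93244842cd9424c932cd942cd942cd942cd942cd9424c932448424c9328d1428d1428d1428d1428d1428d1424c9324c930000024c9324c9324c9324c9324c9324c930408224c930408304083040830408304083040830408204083,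
  0x24c933fff4285042c58509127254a40810424484254a424c9308105285042c585254a408104244840909f254a424c930810528504254a408104244840c1870c187254a424c9308105254a40810424484081050810508105254a424c93254a4081042448429524295242952429524254a424c930000024c9324c9324c9324c9324c9324c9324c930408224c930408304083040830408304083040830408204083,
  0x2ddb728d162cd960993a25cb62d5a724c9508915254a62ddb728d162cd9625cb62d5a724c950891525cb6254a62ddb728d1625cb62d5a724c95089150d1aa25cb6254a62ddb725cb62cd9624c95089152cd962cd9625cb6254a625cb628d1624c950891529d3729d3729d3725cb6254a60000024c950891424c9524c9524c9524c9524c95214252040408914050a5050a5050a5050a5050a5050a4050a404893,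
  0x295292d5a90a149264c92ddba254a8091262e5ca2e5ca295290a149264c92ddba254a8091262a54925cb837ef90a149264c92ddba254a8091262d5a9264c925cb80a149264c92d5a9254a80912625cb82d5a9264c925cb8264c929529254a809126254a82a5490a1470a14925cb800000254a8091260912523c782346722c572244821c37214270912520406058b7058b6060c6058b7058b6058b6050a4058b5,
  0x2ddba0a95626cd82e5ca25cb9099392edd92ad5929d390a95626cd82e5ca25cb9099392ad592ddba2edd90a95626cd82e5ca25cb90993934689264c8264c80a95626cd82edd925cb909939264c825cb926cd80a95626cd829d3925cb9264c825cb92edd90a9550a956264c800000264c8099390993729d3923c760a95522c572244721c382142720c1720408060c5068d4060c6060c6060c7058b6060c6060c7,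
  0x0b165274e52edd7264c60a14a2f5e62b5662e5c70b165274e52edd7264c62f5e62b5662e5c726cd60b165274e52edd7264c62b5662e5c726cd6264c60b165274e52f5e6264c62e5c726cd6264c60e9da0b165274e52b566264c626cd6264c62f5e62f5e60b164274e500000264c6264c629d372a5472a5470b16423c7422c55274e5274e5274e5274e5274e5070e3068d4068d4068d5068d5068d5068d5068d5,
  0x27cf40b97426cd40a9572fdf52bd743c784274e327cf40b97426cd42fdf52bd740b975274e326cd427cf40b97426cd42bd740b975274e326cd40f0df27cf40b97426cd40b975274e326cd40f9f70f9f727cf40b97426cd4274e326cd40b9750b9750b975274e300000274e326cd42ad542ad542ad542ad54274e3078f2274e3274e3274e3274e3274e3274e3070e3070e2070e3070e3070e3070e3070e3070e3,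
  0x2fdf5274e30b1650f8ef2fdf52f5e427cf4274e32fdf5274e30b1652fdf52f5e427cf4274e33c7842fdf5274e30b1652f5e427cf4274e30f8ef0f8ef2f5e4274e32f5e427cf4274e30f9f70f9f70f9f72b564274e327cf4274e32f5e42f5e42f5e42f5e400000274e3274e32ad542b5642b5642b5642b564274e3078f2274e3274e3274e3274e3274e3274e3078f3078f2070e3078f3078f3078f3078f3078f3,
  0x0c90f28d152850630e16306070c99728d15306070c90f3f7e628d152850630e160c997102041020510206102061020628d151020610206102051020630e1630e1630e1630e1628d152850628d152cd962cd962cd962cd962cd962cd9628d1528d150000028d1528d1528d1528d1528d1528d150810428d1508104081040810408104081040810408103081041090f0c90f30e162cd9628d15285060810308104,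
  0x2952628d150c1872c58630607295260c186285063fff72952628d150c1872c58629526102041020510206102061020628d15102061020610205102060c1870c1870c1872952628d15295260c186285062d5a62d5a62d5a62d5a62952628d150000028d1528d1528d1528d1528d1528d1528d150810428d1508104081040810408104081040810408103081040d10f316272d5a62952628d15285060810308104,
  0x2952931e3a2cd9830e1929d393162928d180c99729d39295293efd92cd9829d3911227387070c996112291122911229112292cd98112293468710a1630e1930e1929d392952929d392cd9828d180c9972ddba2ddba2ddba29d3929529000002c5870c99628d1828d1828d1828d1828d1828d18285070c996091260912609126091260912609126091250891431e3a3162929d392cd9828d1809125204060c995,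
  0x2792f0e12f1112f1212f1192f2f12f0d1a92712f1192f0e12f1192f0e12f11a391192f0d1a81192f0a12f0e12f2692f2f12f1112f2712f0d1a83492f1212f0a12f2692f2792f2712f3092f0d1a90a12f0e12f0e1c90a12f2712f000001112f0d1a80d1a72712f0e12f2692f2612f0a12f0d13f0d1a80d12f09939099380993809939099380993809125099372712f0e12f2692f0a12f099370992f0d1a70d13f,
  0x0e93f0e9d90e93f0e93f0e93f0e93f0e93f0e93f0e93f0e9d80e93f122490e93f0e93f0e93f0e93f0e93f0e9d80e93f0e93f0e93f0e93f0e93f0a93f0a93f0e9d90e93f0e93f0e93f0e93f0a93f0e93f0e9d70e9d81293f000000e93f0a93f0d9b90e93f0e93f0e9d80e93f0a93f0e94f0e93f0d93f0e93f0a1470a9550a1480a1480a149099380a1480a1490e93f0e9d70a93f0a1470a13f0e93f0e93f0e93f,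
  0x0f1e72b56832e592a549336692f5e83264a2ad590f1e63bf7712a572a5492f5e83d7a92ad592a5491326637ef712a592f5e812a5912a5912a5912a590f1e72b5682f5e82a5492ad592a54932e5932e590f1e62fdf7000002a5492a5492ddba2e5ca2e5ca0f1e62bd772b5682b5682b5682b5682b5682b5680b1640a9550a9560a9560a9560a9560a9560a9560f1e523c760a9552b5682f5e82a54932e593264a,
  0x2bd760f9f62ad5633e772fdf60f9f72b5652ad5613a75132642ad562fdf60f9f72b5652ad563c787132661326513266132662b5651326613266132662bd760f9f62ad562b5652ad560f9f70f9f70f9f72b565000002b5652ad562edd62edd62edd62edd62b5650b9742b5652b5652b5652b5652b5652b5650b1640b1630b1640b1640b1640b1640b1640b1640b9740b1632ad562b5652ad562edd632e571315f,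
  0x33e772b5650f1e733e77336662bd762b5652416f13a7513a740f1e7336662bd762b5653cf961396f13a7613a751326613a762b56513a7613a7613a762f5e62b5652bd762b56533666336663366633666000002b5652b5652edd62f5e62f5e62f5e62f5e62b5650b9742b5652b5652b5652b5652b5652b5650b9740b9730b1640b9740b9740b9740b9740b9740b9740b9732bd762b5652f5e6336661396f2116f,
  0x1419f1098f2cd9630e1634e95346861428314284142841428414284142841428414284142831428434e9534e9534e9534e9534e9534e951428434e9530e1630e1630e1630e1630e1634e9534e95000002cd962cd962cd962cd9634e952cd9634e952cd960c1860c1860c18634e950c1860c1860c1850c1861098f2346634e9530e162cd9610a170c1840c1851421f34e9530e162cd962c58710a1734e952c587,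
  0x1119f2d5a731626356a634e95316261428314284142841428414284142841428414284142831428434e9534e9534e9534e9534e9534e951428434e95316263162631626316263162634e950000034e95102071020710207356a634e95316260c186306060c1860c1860c18634e950c1860c1860c1850c18623c772346634e951020730606316260c1840c185356a634e9510207306062c587316261020630606,
  0x2ddba2d5a935eb930e1834e98152a53c78610a15152a6152a6152a6152a6152a6152a6152a514a9434e9834e9834e9834e9834e9830e183468710a1631e3a31e3a31e3a35eb92d5a9000003060710a162cd992cd992cd992cd992cd9930e182c58810a170d1a90d1a90d1a90d1a930e180d1a9285070c99635eb9356a922c5930e182cd990d1a72448710a16356a923c7a30e182cd9935eb92d5a92040810a17,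
  0x159af121af159af121af15ab7159af11227159af15ab915ab815ab815ab915ab815ab8152a515ab7159af0e1af159af159af161af159af11228151af121af12249159af159af00000151af1122811227159af121af159af159af159af15a2f11229111af159af0e1af159af159af151af159af0d1a8159af159af121af159af0e1af0d9b90d9af11228159af159af121af151af159af159af159af11229159af,
  0x159df12a57159df162c7119df159df129bf159df162c716ad5162c8162c8162c915ab8162c8162c9159df12a58159df159df161df159df0e9bf159df12a5712a58159df00000159df159df11a39119df129cf12a5915a5f159df159df159df119bf129bf159df0e9d8159df159df159df159df0e9bf159df129bf12a580e9bf0e1c90e1bf129bf129bf129bf159df12a59159df129cf129bf159df129bf159df,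
  0x132653fff616ad5376e833668366c92edd92e5ca172e416ad516ad616ad616ad616ad616ad616ad61326637ef733668376e8376e8376e8376e8376e81326633e77000002edd9366c931e3a3264a3264a132672fdf8336682edd92edd92edd92edd92edd90f1e62bd770e9d9336680e9d90e9d90e9d90e9d91326627cf70e9d72f5e9336682142936ed9366c91326723c782edd9366c92f5e9336682040a36ed9,
  0x17af4172e332e56376e536ed632e562edd7171df172e4172e3172e4172e4172e4172e4172e4172e4376e517af4376e5376e5376e5376e5376e5376e5376e500000376e532e5632e5632e5632e5632e5633e760f9f632e56376e536ed613a7713a7713a770f1e60f1e50f1e60f1e6376e50f1e60f1e60f1e60f9f50f1e432e5633e7613a77376e520c162040733e7613a7632e562fdf733e7613a77376e536ed6,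
  0x17af417af337ef6376e5336662f5e6179ef179ef17af417af3172e417af417af417af417af417af4376e517af4376e5376e5376e5376e5376e5376e500000376e5376e532e56336663366633666336662f5e6376e52f5e6376e52f5e62f5e62f5e62f5e60f9f60f9f50f1e60f9f6376e50f9f60f9f60f9f60f9f50f9f4132672f5e633666376e520c16179ef2fdf7376e5132672fdf72f5e633666376e517a6f,
  0x183031830318303183031830318303183021830338f1338f1338f1338f1338f1338f131830238f1334e9434e9434e9434e9434e9438f1338f130000030e1430e1430e1430e1438f1330e1438f1330e1410207102071020738f1334e9430e1438f1330e1418a0f14a0f38f1334e9430e1414a9538f132c58523c7438f1334e9430e143060514a9538f133060538f1323c7430e143060514a0f14a9538f1330605,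
  0x183031830318303183031830318303183021830338f1338f1338f1338f1338f1338f131830238f13356a4356a4356a4356a4356a438f130000038f131428514285142853972438f13356a4142843468410207102073972438f13142853468414284346841520f3972438f131428534684356a4142843468423c7438f13142853468430605356a4142843468438f1323c743468430605152a7356a41428434684,
  0x1932519325193251932519325193241932418b1338f1538f1538f1538f1538f1538f153c78414a9435eb735eb735eb739f3639726000003468514a9430e1630e1630e1630e1630e1630e1638f1514a951122a39f363972631e3734e9630e1638f1514a9539f363972631e3734e9630e162d5a738f1514a95397262346734e9630e1639f363162738f1514a9531e3734e9630e1615aba39f363162738f1514a95,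
  0x19b3719b361a34619b3719b3619b361932419b35397283f7e73efd7397283dfb73d7a7152a53c786366c9162c7162c939f380000039728152a6152a5316293162939f38316293162939728152a6397283a74939f38162c9356a93162939728152a639f3839f382bd79162c9316292ddba39728152a63162923c7a356a9162c9366c931e3a39728152a6366c9356a931629162c9366c931e3a39728152a63264a,
  0x1a3451ab541a3461a3461a34719b361a3461a3473fff616ad53efd73e7c73a7483d7a73cf973a74816ad516ad63a748000003a74815ab915ab735eb93af5816ad63af5832e5932e593a74832e5932e593a74816ad63af5832e5935eb915ab93a74839f3932e5916ad63af582e5ca32e5915ab9285093a74835eb916ad63af583264a35eb915ab936ed92040a31e3a16ad63af583264a35eb915ab932e5936ed9,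
  0x1b3631ab541ab541ab551ab551ab551ab551ab55172e43fff43b7653b7653b7653b7653b7653b765172e437ef5000003a7463a74635eb7366c7366c7172e53b765336663366633666336663366633666172e53b76533666376e6326473af563a74612a5a172e53b7652edd733666376e6326473af563a746172e53b76532e573a74633666376e620c173af56172e53b76532e573a746162ca33666376e632647,
  0x1b3631b3621b3631b3631b3631b3631b3631b3633b7631bb723b7633b7633b7633b7633b7633b7633b763000003b76336ed436ed436ed436ed436ed437ef417af436ed43b7633af5417af517af517af536ed417af436ed417af53b7633af5413a7713a7737ef417af436ed437ef417af53b7633af541b25f37ef417af436ed433e7537ef417af53b7632040437ef417af436ed416ad733e7537ef4204043b763,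
  0x1bb731bb721b3631bb731bb731bb731bb731bb733b7631bb723b7633b7633b7633b7633b7633b763000003b7633b76336ed4376e4376e4376e4376e4336643b763336643b76333664336643366433664336643b76333664376e43b76313a7713a7713a772fdf53b763172e533664376e43b7631ba6f2026f33e753b763172e533e7533664376e43b7632040433e753b763172e52026f33e7533664204043b763,
  0x1c3821c3821c3821c3821c3821c3821c38138f121c3821c3821c3821c3821c3821c3821c38100000346833468334683346831c3821c3821c3821c3821428514285142851c3821c3821c3821c3821c38223a8f18a8f1c3821c3821c382346831c3821c38222b1f1c3821c3821c3823468318b141c3821c3821c3821c3821c3823468318a8f18b141c3821c3821c3821c382346832028f2029f18b141c3821c382,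
  0x1c3821c3821c3821c3821c3821c3821c381387021c3821c3821c3821c3821c3821c382000001c381346833468334683346831c3821c3821c3821c38214285142853d7a31c3821c3821c3821c3821c3821928f3d7a31c3821c3821c382346831c3821c3823d7a31c3821c3821c38234683356a31c3821c3821c3821c3821c382346831d3a5356a31c3821c3821c3821c382346831928f1d3a5356a31c3821c382,
  0x3cf943cf943cf94356a43cf9438f1338f1318b131d3a41d3a41d3a41d3a41d3a4000001cb9218b1234e9434e9434e9434e9434e9438f1338f1318b13152a73dfb53d7a41d3a538f1334e9438f1318b133dfb53d7a41d3a538f1334e94356a438f1318b133d7a41d3a538f1334e941d3a5356a438f1318b1323c7438f1334e941dbb71d3a5356a438f1318b1338f1323c7419a9f1dbb71d3a5356a438f1318b13,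
  0x3d7a61e3c51a3463d7a63972539725193241d3a41dbb61a3441a3451dbb6000001d3a41932319323356a6356a61a346356a6397253972519324356a63e7c73dfb61a34639725356a63972519324397253dfb61dbb739725356a635eb63972519324356a61dbb7397251a3461dbb735eb6397251932435eb63972527cf61a3461dbb735eb63972519324366c7356a623c771a3461dbb735eb639725193241a2af,
  0x1ebd41ab543af553af553e7c619b361dbb53e7c61ab531ab531ebd4000001dbb619b3519b341e3c6366c61ab543af553af55366c619b36366c6366c63af551ab543af55366c63af5519b363e7c63dfb736ed61ab543af55366c636ed63af551e3c73e7c6366c61ab543af55366c61e3c719b363af551e3c735eb71ab543af55366c61e3c719b36244863af551aabf1ab543af55366c61e3c719b362040736ed6,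
  0x1b3633b7633b7633efd436ed43efd43efd43efd41b3621f3e2000001ebd41ebd41ebd41ebd41ebd41b3633b7633b76336ed436ed436ed436ed436ed41b3633b76336ed43b7631ebd53efd43e7c516ad71b3633b76336ed4376e43b7631ebd53efd43e7c51b3633b76336ed41ebd5376e43b7631ebd53efd41b3633b76336ed41ebd51e3c7376e43b763204041b3633b76336ed41ebd51e3c71b2cf204043b763,
  0x3bf721fbf11fbf21fbf21fbf21fbf21fbf21fbf21fbf1000001fbf21fbf21fbf21fbf21fbf21fbf21fbf21fbf21fbf21fbf236ed336ed336ed336ed31fbf21fbf21fbf21fbf21fbf23efd317af517af51fbf21fbf236ed31fbf21fbf21fbf23efd3202df1fbf21fbf236ed337ef31fbf21fbf21fbf23efd31fbf21fbf236ed31ebd537ef31fbf21fbf21fbf21fbf21fbf236ed31ebd5202df37ef31fbf21fbf2,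
  0x3b7621fbf11fbf21fbf21fbf21fbf21fbf21fbf2000001fbf11fbf21fbf21fbf21fbf21fbf21fbf21fbf21fbf21fbf21fbf2376e3376e3376e3376e31fbf21fbf21fbf21fbf21fbf217af517af517af51fbf21fbf237ef31fbf21fbf21fbf220aef202ef1fbf21fbf21b36437ef31fbf21fbf21fbf22036f1fbf21fbf21b36422aef37ef31fbf21fbf21fbf21fbf21fbf21b364202ef202ef37ef31fbf21fbf2,
  0x3cf913cf913cf913cf913cf9138f1100000000003870138701387013870138701387010000000000183041830418304183043cf9138f11387013870123b0f2130f1cb0f3cf9138f113870138f11387012c47f2331f3cf9138f11387011cb9438f113870123b1f3cf9138f11387011cb0f1cb9438f11387013cf9138f11387012430f2131f1cb9438f113870138f11387012030f2340f2031f1cb9438f1138701,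
  0x1c3821c3821c3821c3821c3821c38200000387021c3821c3821c3821c3821c3821c3821c3811c3811830418304183043d7a31c3821c3821c3821c38221b0f1d30f3d7a31c3821c3821c3821c3821c38223b2f3d7a31c3821c3821c382397231c3821c3823d7a31c3821c3821c3821d3a5397231c3821c3821c3821c3821c3821d30f1d3a5397231c3821c3821c3821c3822030f2032f1d3a5397231c3821c382,
  0x3dfb53dfb53dfb539f34397240000038f131cb9338f1338f1338f1338f1338f1338f131cb921cb9219325193251932539f343972438f1338f1318b131db1f3dfb539f343972438f13356a438f131cb933dfb539f343972438f1339f343972438f131cb9339f343972438f131dbb739f343972438f131cb9323c7438f131db1f1dbb739f343972438f131cb9338f1323c741db1f1dbb739f343972438f131cb93,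
  0x3e7c71e3c51e3c639f3600000397251d3a41d3a4397251e3c41e3c539725397251d3a41d3a31d3a319b3719b371a34639f363972539725193243d7a63e7c73a7461e3c63972535eb6397251d3a4397253a74639f36397253a74639f36397251d3a439f3639f36397251e3c63a74639f36397251d3a43a7463972527cf61e3c63a74639f36397251d3a41e32f20b2f1e32f1e3c63a74639f36397251d3a420b2f,
  0x1ebd41ebd43af550000039f361dbb61dbb53dfb71ebd31ebd31ebd43af553af551dbb51dbb43af553efd61ab543af553af5539f3619b361a3471a3473af551ebd43af55366c63af551dbb639f363dfb73a7461ebd43af553a74639f363af553a74639f3639f361ebd43af553a74639f361dbb63af553a7461eb3f1ebd43af553a74639f361dbb6244863af551eb3f1ebd43af553a74639f361dbb61eb3f1eb4f,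
  0x1f3e33b763000003a7443a7443dfb53e7c53e7c51f3e21f3e23b7633b7633b7633b7633b7633b7631b3633b7633b7633a7443a7441ab551ab551ab551f3e33b76336ed43b7633af543a7443e7c52034f1f3e33b7633af543a7443b7633af543a7443e7c51f3e33b7633af543a7441e3c73b7633af543a7441f3e33b7633af543a7441e3c71f34f3b763204041f3e33b7633af543a7441e3c72034f204043b763,
  0x3b762000001fbf21fbf21fbf21fbf21fbf21fbf21fbf11fbf11fbf21fbf21fbf21fbf21fbf21fbf21fbf21fbf21fbf21fbf23efd31b3641b3641b3641fbf21fbf21fbf21fbf21fbf23efd320b5f2035f1fbf21fbf23af531fbf21fbf21fbf23efd32035f1fbf21fbf23af531ebd51fbf21fbf21fbf23efd31fbf21fbf23af531ebd52235f1fbf21fbf21fbf21fbf21fbf23af531ebd52035f2036f1fbf21fbf2,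
  0x00000000003b7613f7e13f7e13f7e13f7e13f7e100000000003b7613b7613b7613b7613b7613b7613b7613b7613b7613f7e11bb741bb741bb741bb743bf713b7613bf713b7613f7e12336f20b6f2036f3bf713b7611f3e43bf713b7613f7e120b6f2d40f3bf713b7611f3e42336f3bf713b7613f7e12036f3bf713b7611f3e422b6f2436f3bf713b7613f7e13bf713b7611f3e42036f22c0f2036f3bf713b761]

theorem checkPlan_plan : checkPlan plan = true := by
  decide +kernel

theorem covered_plan : ([11, 18, 81, 88].all fun k => positions.all fun q =>
    !(nbrs (bit k)).testBit q || covered plan k q (unseenMask k q)) = true := by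
  decide +kernel

theorem checkTable_cornerTable : ∀ k < 64, ∀ q < 64, checkTable cornerTable k q = true := by
  decide +kernel

/-! ### Assembling the two stages. -/

theorem corner_of_isCorner {s : Square} (h : s ∈ corners) : pos s ∈ [11, 18, 81, 88] := by
  revert s; decide

/-- White wins from every corner configuration without knowing where the Black king is. -/
theorem exists_winsFrom_corner : ∃ τ : Strategy,
    ∀ c : Config, c.IsInitial → c.view.IsCorner → τ.WinsFrom c := by
  -- The strategy may depend on White's squares but not on `b`, so White can select it from the
  -- first view.
  have key : ∀ K Q : Square, ∃ σ : Strategy, K ∈ corners → Adjacent K Q → ∀ b,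
      Config.IsInitial ⟨K, some Q, b⟩ → σ.WinsFrom ⟨K, some Q, b⟩ := by
    intro K Q
    by_cases h : K ∈ corners ∧ Adjacent K Q ∧ K ≠ Q
    · obtain ⟨hK, ha, hne⟩ := h
      have hc := covered_plan
      simp only [List.all_eq_true] at hc
      have hc := hc _ (corner_of_isCorner hK) _ (pos_mem_positions Q)
      rw [ha.testBit, Bool.not_true, Bool.false_or] at hc
      have hs := sound_of_checkPlan handsOver_id (fun _ h => h.elim) checkPlan_plan
      obtain ⟨σ, hσ⟩ : BeliefWin id K Q Set.univ := .of_unseen handsOver_id <|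
        (beliefWin_of_covered hs hne hc).mono fun t ht => testBit_unseenMask ht.2.1 ht.2.2.1 ht.2.2.2
      exact ⟨σ, fun _ _ b hb => hσ _ ⟨rfl, rfl, trivial, hb⟩⟩
    · exact ⟨fun _ => .king K, fun hK ha b hb => absurd ⟨hK, ha, (isInitial_iff.1 hb).1⟩ h⟩
  choose f hf using key
  -- The strategies for the various corner configurations are merged by reading the White squares
  -- off the first view; the default values are irrelevant, as a corner view has a queen.
  refine ⟨fun l => match l.head? with
    | some v => f v.king (v.queen.getD v.king) l
    | none => .king (0, 0), ?_⟩
  rintro ⟨K, Q, b⟩ hi ⟨hK, q, rfl : Q = some q, ha⟩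
  exact (hf K q hK ha b hi).transfer _ fun t => rfl

end FogChess

theorem mainTheorem1 :
    ∃ τ : FogChess.Strategy,
      (∀ c : FogChess.Config, c.IsInitial → c.view.IsCorner → τ.WinsFrom c) ∧
      ∀ c : FogChess.Config, c.IsInitial →
        ∃ σ : FogChess.Strategy, (FogChess.twoStage σ τ).WinsFrom c := by
  open FogChess in
  obtain ⟨τ, hτ⟩ := exists_winsFrom_corner
  refine ⟨τ, hτ, ?_⟩
  rintro ⟨K, _, b⟩ ⟨Q, rfl, hKQ, hKb, hQb⟩
  -- The known initial square of the Black king enters here, as a one-point belief; it is needed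
  -- only if the starting rank is 15.
  obtain ⟨σ, hσ⟩ := beliefWin_of_checkTable (handsOver_twoStage hτ) checkTable_cornerTable hKQ
    (B := {b}) (.inr Set.subsingleton_singleton)
  exact ⟨σ, hσ _ ⟨rfl, rfl, rfl, isInitial_iff.2 ⟨hKQ, hKb, hQb⟩⟩⟩
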